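/- Let $m_1,m_2,K,n\ge 1$ be integers and let $(X_1,Y_1),\dots,(X_n,Y_n)$ be i.i.d. with law $\mathbf P$ on $([m_1]\times[m_2])\times\{-1,+1\}$; write $X_l=(i_l,j_l)$. For $M\in\mathbb R^{m_1\times m_2}$ put $R(M)=\mathbf P(Y M_X<0)$ and $r_n^h(M)=\frac1n\sum_{l=1}^n(1-Y_lM_{X_l})_+$. Let $\pi^\gamma$ be either the Gamma distribution $\Gamma(\alpha,\beta)$ (shape $\alpha$, rate $\beta$) or the inverse-Gamma distribution $\Gamma^{-1}(\alpha,\beta)$ (density proportional to $x^{-\alpha-1}e^{-\beta/x}$ on $(0,\infty)$), with $\alpha,\beta>0$. Let $\mathcal F$ be the set of laws $\rho$ of $(L,R,\gamma)\in\mathbb R^{m_1\times K}\times\mathbb R^{m_2\times K}\times(0,\infty)^K$ under which all coordinates are independent, $L_{ik}\sim\mathcal N(L^0_{ik},v^L_{ik})$, $R_{jk}\sim\mathcal N(R^0_{jk},v^R_{jk})$ with real means and positive variances, and $\gamma_k\sim\rho^{\gamma_k}$ with arbitrary probability distributions $\rho^{\gamma_k}$ on $(0,\infty)$. For $\lambda>0$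 let $AVB(\rho)=r_n^h(L^0R^{0\top})+\mathcal R(\rho,\lambda)$, where $$\begin{aligned}\mathcal R(\rho,\lambda)={}&\frac1n\sum_{l=1}^n\sum_{k=1}^K\Big[\tfrac2\pi\sqrt{v^L_{i_lk}v^R_{j_lk}}+|R^0_{j_lk}|\sqrt{\tfrac2\pi v^L_{i_lk}}+|L^0_{i_lk}|\sqrt{\tfrac2\pi v^R_{j_lk}}\Big]\\&+\frac1\lambda\Big(\frac12\sum_{k}\mathbb E_\rho\big[\tfrac1{\gamma_k}\big]\Big[\sum_i(v^L_{ik}+(L^0_{ik})^2)+\sum_j(v^R_{jk}+(R^0_{jk})^2)\Big]-\frac12\sum_k\Big[\sum_i\log v^L_{ik}+\sum_j\log v^R_{jk}\Big]\\&\qquad+\sum_k\Big[\mathcal K(\rho^{\gamma_k},\pi^\gamma)+\tfrac{m_1+m_2}2\big(\mathbb E_\rho[\log\gamma_k]-1\big)\Big]\Big),\end{aligned}$$ $\mathcal K$ is the Kullback divergence, and $AVB(\rho)=+\infty$ if one of the expectations or divergences is not finite. Let $\widetilde\rho_\lambda$ be any minimizer of $AVB$ over $\mathcal F$. Let $M^B$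 be a Bayes matrix: $M^B_{ij}\in\{-1,1\}$ is the sign of $\mathbb E[Y\mid X=(i,j)]$ (either sign where this is zero or undefined). For a matrix $M$ of rank $r$ let $\ell(M)$ be the infimum of $\max(\max_{i,k}|U_{ik}|,\max_{j,k}|V_{jk}|)$ over all factorizations $M=UV^\top$ with $U,V$ having $r$ columns. There is a constant $\mathcal C>0$ depending only on $\pi^\gamma$ (the family and $\alpha,\beta$) such that in the noiseless case $Y=\mathrm{sign}(M^B_X)$ a.s., if $\mathrm{rank}(M^B)\le K$ and $\lambda=2n$, then for every $\epsilon>0$, with probability at least $1-2\epsilon$, $$\int R(LR^\top)\,d\widetilde\rho_\lambda\le \mathcal C'\;\frac{\mathrm{rank}(M^B)(m_1+m_2)\,[\log n+\ell^2(M^B)]+\log\frac1\epsilon}{n}$$ holds with the constant $\mathcal C'=\mathcal C K$, which depends only on $\pi^\gamma$ and on the number $K$ of components of the prior; and, when $\pi^\gamma$ is a Gamma distribution and $K\le m_1+m_2$, it holds with $\mathcal C'=\mathcal C$, independent of $K$. -/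

import Mathlib

open MeasureTheory ProbabilityTheory
open scoped NNReal ENNReal

namespace OneBit

noncomputable section

/-! ### Matrices -/

/-- Entrywise maximum norm `max_{i,j} |A i j|` (equal to `0` for a matrix without entries). -/
def maxNorm {p q : ℕ} (A : Matrix (Fin p) (Fin q) ℝ) : ℝ :=
  ⨆ x : Fin p × Fin q, |A x.1 x.2|

/-- `ℓ(M)`: infimum of `max (‖U‖_max) (‖V‖_max)` over the factorizations `M = U Vᵀ` of `M` in which
`U` and `V` have exactly `rank M` columns. -/
def ell {p q : ℕ} (M : Matrix (Fin p) (Fin q) ℝ) : ℝ :=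
  sInf {t : ℝ | ∃ (U : Matrix (Fin p) (Fin M.rank) ℝ) (V : Matrix (Fin q) (Fin M.rank) ℝ),
    M = U * V.transpose ∧ t = max (maxNorm U) (maxNorm V)}

/-! ### The classification problem -/

/-- The labels `-1` and `+1`. -/
abbrev Label : Type := ({-1, 1} : Set ℝ)

/-- An observation: the position of an entry and its label. -/
abbrev Obs (m₁ m₂ : ℕ) : Type := (Fin m₁ × Fin m₂) × Label

/-- The risk `R(M) = P(Y M_X < 0)`. -/
def risk {m₁ m₂ : ℕ} (P : Measure (Obs m₁ m₂)) (M : Matrix (Fin m₁) (Fin m₂) ℝ) : ℝ :=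
  P.real {z | (z.2 : ℝ) * M z.1.1 z.1.2 < 0}

/-- The empirical hinge risk of `M` on the sample `S`. -/
def hingeRisk {m₁ m₂ n : ℕ} (S : Fin n → Obs m₁ m₂) (M : Matrix (Fin m₁) (Fin m₂) ℝ) : ℝ :=
  (1 / (n : ℝ)) * ∑ l, max (1 - ((S l).2 : ℝ) * M (S l).1.1 (S l).1.2) 0

/-- The regression function `η(i,j) = E[Y | X = (i,j)]`; it is `0` by convention at an entry that is
observed with probability zero. -/
def regression {m₁ m₂ : ℕ} (P : Measure (Obs m₁ m₂)) (i : Fin m₁) (j : Fin m₂) : ℝ :=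
  ∫ z, (z.2 : ℝ) ∂(ProbabilityTheory.cond P (Prod.fst ⁻¹' {(i, j)}))

/-- `M` is a Bayes matrix `(sign η(i,j))`, with entries in `{-1, 1}`; where `η(i,j)` vanishes or is
not determined by `P`, either sign is allowed. -/
def IsBayesMatrix {m₁ m₂ : ℕ} (P : Measure (Obs m₁ m₂)) (M : Matrix (Fin m₁) (Fin m₂) ℝ) : Prop :=
  ∀ i j, (M i j = -1 ∨ M i j = 1) ∧
    (regression P i j ≠ 0 → M i j = Real.sign (regression P i j))

/-! ### The prior on the variances -/

/-- The inverse-Gamma distribution with shape `α` and scale `β`. -/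
def invGammaMeasure (α β : ℝ) : Measure ℝ :=
  volume.withDensity fun x =>
    ENNReal.ofReal (if 0 < x then β ^ α / Real.Gamma α * x ^ (-α - 1) * Real.exp (-β / x) else 0)

/-- The two families of priors for the variances. -/
inductive PriorFamily
  | gamma
  | invGamma

/-- The prior `π^γ`: `Γ(α, β)` with shape `α` and rate `β`, or `Γ⁻¹(α, β)`. -/
def priorGamma : PriorFamily → ℝ → ℝ → Measure ℝ
  | PriorFamily.gamma, α, β => gammaMeasure α β
  | PriorFamily.invGamma, α, β => invGammaMeasure α β

/-! ### The variational class and the estimator -/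

/-- The parameters `(L⁰, R⁰, v^L, v^R, ρ^{γ_1}, …, ρ^{γ_K})` of a member of the variational
class `𝓕`. -/
structure VarParam (m₁ m₂ K : ℕ) where
  L0 : Matrix (Fin m₁) (Fin K) ℝ
  R0 : Matrix (Fin m₂) (Fin K) ℝ
  vL : Fin m₁ → Fin K → ℝ≥0
  vR : Fin m₂ → Fin K → ℝ≥0
  ργ : Fin K → Measure ℝ
  vL_pos : ∀ i k, 0 < vL i k
  vR_pos : ∀ j k, 0 < vR j k
  ργ_prob : ∀ k, IsProbabilityMeasure (ργ k)
  ργ_pos : ∀ k, ργ k (Set.Iic 0) = 0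

/-- The parameter space of `θ = (L, R, γ)`. -/
abbrev Theta (m₁ m₂ K : ℕ) : Type :=
  (Fin m₁ → Fin K → ℝ) × (Fin m₂ → Fin K → ℝ) × (Fin K → ℝ)

/-- The member of `𝓕` with the given parameters: all coordinates of `(L, R, γ)` are independent,
`L i k ∼ 𝓝(L⁰ i k, v^L i k)`, `R j k ∼ 𝓝(R⁰ j k, v^R j k)` and `γ_k ∼ ρ^{γ_k}`. -/
def VarParam.toMeasure {m₁ m₂ K : ℕ} (ρ : VarParam m₁ m₂ K) : Measure (Theta m₁ m₂ K) :=
  (Measure.pi fun i => Measure.pi fun k => gaussianReal (ρ.L0 i k) (ρ.vL i k)).prod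
    ((Measure.pi fun j => Measure.pi fun k => gaussianReal (ρ.R0 j k) (ρ.vR j k)).prod
      (Measure.pi ρ.ργ))

/-- The risk of `L Rᵀ` averaged over `(L, R, γ) ∼ ρ`. -/
def expectedRisk {m₁ m₂ K : ℕ} (P : Measure (Obs m₁ m₂)) (ρ : VarParam m₁ m₂ K) : ℝ :=
  ∫ θ, risk P (Matrix.of θ.1 * (Matrix.of θ.2.1).transpose) ∂ρ.toMeasure

/-- The quantity `𝓡(ρ, lam)`, for `ρ` such that the expectations and divergences in it are
finite. -/
def penalty {m₁ m₂ K n : ℕ} (π : Measure ℝ) (lam : ℝ) (S : Fin n → Obs m₁ m₂)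
    (ρ : VarParam m₁ m₂ K) : ℝ :=
  (1 / (n : ℝ)) * ∑ l, ∑ k,
      (√(ρ.vL (S l).1.1 k * (2 / Real.pi)) * √(ρ.vR (S l).1.2 k * (2 / Real.pi))
        + |ρ.R0 (S l).1.2 k| * √(ρ.vL (S l).1.1 k * (2 / Real.pi))
        + |ρ.L0 (S l).1.1 k| * √(ρ.vR (S l).1.2 k * (2 / Real.pi)))
    + (1 / lam) *
      ((1 / 2) * ∑ k, (∫ g, 1 / g ∂(ρ.ργ k)) *
          (∑ i, ((ρ.vL i k : ℝ) + ρ.L0 i k ^ 2) + ∑ j, ((ρ.vR j k : ℝ) + ρ.R0 j k ^ 2))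
        - (1 / 2) * ∑ k, (∑ i, Real.log (ρ.vL i k) + ∑ j, Real.log (ρ.vR j k))
        + ∑ k, ((InformationTheory.klDiv (ρ.ργ k) π).toReal
            + ((m₁ : ℝ) + m₂) / 2 * ((∫ g, Real.log g ∂(ρ.ργ k)) - 1)))

open Classical in
/-- The approximate variational bound `AVB(ρ) = r_n^h(L⁰ R⁰ᵀ) + 𝓡(ρ, lam)`. It is `+∞` unless all of
`E[1/γ_k]`, `E[log γ_k]` and `KL(ρ^{γ_k}, π)` are finite: near `0` the term in `1/γ_k`, whose
coefficient is positive, dominates the logarithm. -/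
def avb {m₁ m₂ K n : ℕ} (π : Measure ℝ) (lam : ℝ) (S : Fin n → Obs m₁ m₂)
    (ρ : VarParam m₁ m₂ K) : EReal :=
  if ∀ k, Integrable (fun g : ℝ => 1 / g) (ρ.ργ k) ∧ Integrable Real.log (ρ.ργ k) ∧
      InformationTheory.klDiv (ρ.ργ k) π ≠ ⊤
  then ((hingeRisk S (ρ.L0 * ρ.R0.transpose) + penalty π lam S ρ : ℝ) : EReal)
  else ⊤

/-- `ρ` is a variational estimator `ρ̃_lam` for the sample `S`: a minimizer of `AVB` over `𝓕`. -/
def IsVariationalEstimator {m₁ m₂ K n : ℕ} (π : Measure ℝ) (lam : ℝ) (S : Fin n → Obs m₁ m₂)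
    (ρ : VarParam m₁ m₂ K) : Prop :=
  ∀ ρ' : VarParam m₁ m₂ K, avb π lam S ρ ≤ avb π lam S ρ'

/-- The rate `(rank(M) (m₁ + m₂) (log n + ℓ(M)²) + log(1/ε)) / n`. -/
def rate {m₁ m₂ : ℕ} (M : Matrix (Fin m₁) (Fin m₂) ℝ) (n : ℕ) (ε : ℝ) : ℝ :=
  ((M.rank : ℝ) * ((m₁ : ℝ) + m₂) * (Real.log n + ell M ^ 2) + Real.log (1 / ε)) / n

end

end OneBit

namespace OneBit

/-! ### The entropy inequality -/

section EntropyBound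

variable {E F : Type*} [MeasurableSpace E] [MeasurableSpace F]

/-! The argument is PAC-Bayesian, with a comparison parameter adapted to the rank of the Bayes
matrix.

For a fixed matrix `M` the zero-one loss takes only the values 0 and 1, so `E exp(-loss) = 1 - (1 -
e⁻¹) R(M)`. By independence and `1 - x ≤ exp(-x)`, the variable `deviation` has exponential moment
at most 1 (`integral_exp_deviation_le`). Integrating over the hierarchical prior, Fubini and Markov
give one event of probability at least `1 - ε` (`measure_integral_exp_deviation_lt`). On it, the
Donsker-Varadhan inequality transfers the bound simultaneously to every admissible `ρ`, at the price
of an entropy term (`integral_le_entropy_add_log`). That term is computed by a chain rule: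
divergence of the variances plus the mean Gaussian divergence of the factors given the variances.
The zero-one loss is then dominated by the hinge loss at the means plus the mean fluctuation of `L
Rᵀ`, so `2n · AVB(ρ) + log(1/ε)` controls `(n/2) E_ρ R` (`half_expectedRisk_le`).

A minimizer does at least as well as any comparison parameter. Without noise the Bayes matrix has
hinge risk 0, so only the penalty remains, and no square-root term appears in the rate. The
comparison means are a factorization of the Bayes matrix with `rank` columns, padded by zeros. A
column with variance `1/n²` and `γ_k` conditioned on `[1, 2]` costs `O((m₁+m₂)(log n + ℓ²))`; using
this for all columns gives the factor `K`. A Gamma prior puts polynomial mass near 0, so a zero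
column can instead take variance `1/n` and `γ_k ≈ 1/n`. Its Gaussian prior and posterior then nearly
coincide and it costs only `O(log n)`, which removes `K` when `K ≤ m₁+m₂`. If `n < m₁+m₂`, the rate
exceeds 1 because `rank · ℓ² ≥ 1`, and there is nothing to prove. -/

/-- `c` bounds the relative entropy of `ρ` with respect to `π`, in the dual formulation of Donsker and
Varadhan. -/
def EntropyBound (ρ π : Measure E) (c : ℝ) : Prop :=
  ∀ h : E → ℝ, Measurable h → (∃ B, ∀ x, |h x| ≤ B) →
    ∫ x, h x ∂ρ ≤ c + Real.log (∫ x, Real.exp (h x) ∂π)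

lemma integrable_of_abs_le {μ : Measure E} [IsFiniteMeasure μ] {h : E → ℝ} (hm : Measurable h)
    {B : ℝ} (hB : ∀ x, |h x| ≤ B) : Integrable h μ :=
  Integrable.of_bound hm.aestronglyMeasurable B (ae_of_all _ fun x => hB x)

lemma integrable_exp_of_abs_le {μ : Measure E} [IsFiniteMeasure μ] {h : E → ℝ} (hm : Measurable h)
    {B : ℝ} (hB : ∀ x, |h x| ≤ B) : Integrable (fun x => Real.exp (h x)) μ :=
  integrable_of_abs_le hm.exp (B := Real.exp B) fun x => by
    rw [abs_of_pos (Real.exp_pos _)]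
    exact Real.exp_le_exp.2 (le_of_abs_le (hB x))

lemma abs_log_integral_exp_le {μ : Measure E} [IsProbabilityMeasure μ] {h : E → ℝ}
    (hm : Measurable h) {B : ℝ} (hB : ∀ x, |h x| ≤ B) :
    |Real.log (∫ x, Real.exp (h x) ∂μ)| ≤ B := by
  have hi := integrable_exp_of_abs_le (μ := μ) hm hB
  have h1 : Real.exp (-B) ≤ ∫ x, Real.exp (h x) ∂μ := by
    have := integral_mono (integrable_const (Real.exp (-B))) hi
      fun x => Real.exp_le_exp.2 (neg_le_of_abs_le (hB x))
    simpa using this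
  have h2 : ∫ x, Real.exp (h x) ∂μ ≤ Real.exp B := by
    have := integral_mono hi (integrable_const (Real.exp B))
      fun x => Real.exp_le_exp.2 (le_of_abs_le (hB x))
    simpa using this
  have h0 := (Real.exp_pos (-B)).trans_le h1
  exact abs_le.2 ⟨(Real.le_log_iff_exp_le h0).2 h1, (Real.log_le_iff_le_exp h0).2 h2⟩

lemma integral_exp_pos_of_abs_le {μ : Measure E} [IsProbabilityMeasure μ] {h : E → ℝ}
    (hm : Measurable h) {B : ℝ} (hB : ∀ x, |h x| ≤ B) : 0 < ∫ x, Real.exp (h x) ∂μ :=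
  integral_exp_pos (integrable_exp_of_abs_le hm hB)

/-- The divergence of `ρ` from the tilted measure `π.tilted h` is nonnegative, and it equals the
divergence from `π` minus `∫ h dρ` plus the log-moment of `h`. -/
lemma entropyBound_klDiv {ρ π : Measure E} [IsProbabilityMeasure ρ] [IsProbabilityMeasure π]
    (hk : InformationTheory.klDiv ρ π ≠ ⊤) :
    EntropyBound ρ π (InformationTheory.klDiv ρ π).toReal := by
  rintro h hm ⟨B, hB⟩
  obtain ⟨hac, hinteg⟩ := InformationTheory.klDiv_ne_top_iff.1 hk
  have hi : Integrable h ρ := integrable_of_abs_le hm hB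
  have he := integrable_exp_of_abs_le (μ := π) hm hB
  have : IsProbabilityMeasure (π.tilted h) := isProbabilityMeasure_tilted he
  have h1 := integral_llr_tilted_right hac hi he hinteg
  have h2 := InformationTheory.integral_llr_add_sub_measure_univ_nonneg
    (hac.trans (absolutelyContinuous_tilted he)) (integrable_llr_tilted_right hac hi hinteg he)
  rw [InformationTheory.toReal_klDiv_of_measure_eq hac (by simp)]
  simp only [probReal_univ] at h2
  linarith

/-- The bound for a product of probability measures, where the second factor of the reference measure
may depend on the first coordinate through a measurable parametrisation. -/
lemma integral_prod_le_of_entropyBound {G : Type*} [MeasurableSpace G] {ρ₁ π₁ : Measure E}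
    {ρ₂ : Measure F} {π₂ : Measure G} [IsProbabilityMeasure ρ₁] [IsProbabilityMeasure π₁]
    [IsProbabilityMeasure ρ₂] [IsProbabilityMeasure π₂] {c₁ : ℝ} {c₂ : E → ℝ} {Φ : E → G → F}
    (hΦ : Measurable (Function.uncurry Φ)) (h₁ : EntropyBound ρ₁ π₁ c₁) (hc₂ : Integrable c₂ ρ₁)
    (h₂ : ∀ᵐ x ∂ρ₁, EntropyBound ρ₂ (π₂.map (Φ x)) (c₂ x)) {h : E → F → ℝ}
    (hm : Measurable (Function.uncurry h)) {B : ℝ} (hB : ∀ x y, |h x y| ≤ B) :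
    ∫ z, h z.1 z.2 ∂(ρ₁.prod ρ₂) ≤
      c₁ + ∫ x, c₂ x ∂ρ₁ +
        Real.log (∫ z, Real.exp (h z.1 (Φ z.1 z.2)) ∂(π₁.prod π₂)) := by
  have hhi : Integrable (Function.uncurry h) (ρ₁.prod ρ₂) :=
    integrable_of_abs_le hm (B := B) fun z => hB z.1 z.2
  have hgm : Measurable (fun z : E × G => h z.1 (Φ z.1 z.2)) :=
    hm.comp (measurable_fst.prodMk hΦ)
  have hgb : ∀ z : E × G, |h z.1 (Φ z.1 z.2)| ≤ B := fun z => hB _ _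
  -- The conditional log-moment is again bounded and measurable, so it is a legitimate test function
  -- for the first factor; its exponential recovers the inner integral.
  set g : E → ℝ := fun x => Real.log (∫ y, Real.exp (h x (Φ x y)) ∂π₂) with hg
  have hsec : ∀ x, Measurable fun y => h x (Φ x y) := fun x => hgm.comp measurable_prodMk_left
  have hgmeas : Measurable g :=
    Real.measurable_log.comp
      (hgm.exp.stronglyMeasurable.integral_prod_right (ν := π₂)).measurable
  have hgB : ∀ x, |g x| ≤ B := fun x => abs_log_integral_exp_le (hsec x) fun y => hB _ _
  have hstep : ∀ᵐ x ∂ρ₁, ∫ y, h x y ∂ρ₂ ≤ c₂ x + g x := by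
    filter_upwards [h₂] with x hx
    have hxm : Measurable (h x) := hm.comp measurable_prodMk_left
    have := hx (h x) hxm ⟨B, hB x⟩
    have hΦx : Measurable (Φ x) := hΦ.comp measurable_prodMk_left
    rwa [integral_map hΦx.aemeasurable hxm.exp.aestronglyMeasurable] at this
  have hgi : Integrable g ρ₁ := integrable_of_abs_le hgmeas hgB
  calc ∫ z, h z.1 z.2 ∂(ρ₁.prod ρ₂) = ∫ x, ∫ y, h x y ∂ρ₂ ∂ρ₁ := integral_prod _ hhi
    _ ≤ ∫ x, (c₂ x + g x) ∂ρ₁ := integral_mono_ae hhi.integral_prod_left (hc₂.add hgi) hstep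
    _ = ∫ x, c₂ x ∂ρ₁ + ∫ x, g x ∂ρ₁ := integral_add hc₂ hgi
    _ ≤ ∫ x, c₂ x ∂ρ₁ + (c₁ + Real.log (∫ x, Real.exp (g x) ∂π₁)) := by
        gcongr; exact h₁ g hgmeas ⟨B, hgB⟩
    _ = _ := by
        have : ∀ x, Real.exp (g x) = ∫ y, Real.exp (h x (Φ x y)) ∂π₂ := fun x =>
          Real.exp_log (integral_exp_pos_of_abs_le (hsec x) fun y => hB _ _)
        simp_rw [this]
        rw [integral_prod _ (integrable_exp_of_abs_le hgm hgb)]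
        ring

lemma EntropyBound.prod {ρ₁ π₁ : Measure E} {ρ₂ π₂ : Measure F} [IsProbabilityMeasure ρ₁]
    [IsProbabilityMeasure π₁] [IsProbabilityMeasure ρ₂] [IsProbabilityMeasure π₂] {c₁ c₂ : ℝ}
    (h₁ : EntropyBound ρ₁ π₁ c₁) (h₂ : EntropyBound ρ₂ π₂ c₂) :
    EntropyBound (ρ₁.prod ρ₂) (π₁.prod π₂) (c₁ + c₂) := by
  rintro h hm ⟨B, hB⟩
  have := integral_prod_le_of_entropyBound (Φ := fun (_ : E) (y : F) => y) (c₂ := fun _ => c₂)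
    (h := fun x y => h (x, y)) (π₂ := π₂) measurable_snd h₁ (integrable_const _)
    (ae_of_all _ fun x => by simpa using h₂) hm (B := B) fun x y => hB _
  simpa using this

lemma EntropyBound.map {ρ π : Measure E} {c : ℝ} (h : EntropyBound ρ π c) {f : E → F}
    (hf : Measurable f) : EntropyBound (ρ.map f) (π.map f) c := by
  rintro g hm ⟨B, hB⟩
  rw [integral_map hf.aemeasurable hm.aestronglyMeasurable,
    integral_map hf.aemeasurable hm.exp.aestronglyMeasurable]
  exact h _ (hm.comp hf) ⟨B, fun x => hB _⟩

lemma EntropyBound.pi {n : ℕ} {ρ π : Fin n → Measure E} [∀ i, IsProbabilityMeasure (ρ i)]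
    [∀ i, IsProbabilityMeasure (π i)] {c : Fin n → ℝ} (h : ∀ i, EntropyBound (ρ i) (π i) (c i)) :
    EntropyBound (Measure.pi ρ) (Measure.pi π) (∑ i, c i) := by
  induction n with
  | zero =>
    rintro g hm ⟨B, hB⟩
    rw [Measure.pi_of_empty ρ, Measure.pi_of_empty π]
    simp
  | succ n ih =>
    have hs := (h 0).prod (ih (ρ := fun i => ρ i.succ) (π := fun i => π i.succ) fun i => h i.succ)
    have e := hs.map (MeasurableEquiv.piFinSuccAbove (fun _ => E) 0).symm.measurable
    rw [Fin.sum_univ_succ]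
    have h1 := (measurePreserving_piFinSuccAbove ρ 0).symm.map_eq
    have h2 := (measurePreserving_piFinSuccAbove π 0).symm.map_eq
    simp only [Fin.zero_succAbove] at h1 h2
    rwa [h1, h2] at e

end EntropyBound

/-! ### Gaussian measures -/

lemma integrable_sub_sq_gaussianReal (m a : ℝ) (v : ℝ≥0) :
    Integrable (fun x => (x - a) ^ 2) (gaussianReal m v) :=
  ((memLp_id_gaussianReal' 2 (by simp)).sub (memLp_const a)).integrable_sq

lemma integral_sub_sq_gaussianReal (m : ℝ) (v : ℝ≥0) :
    ∫ x, (x - m) ^ 2 ∂(gaussianReal m v) = v := by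
  have := variance_eq_integral (μ := gaussianReal m v) (X := fun x : ℝ => x) measurable_id.aemeasurable
  rw [variance_fun_id_gaussianReal, integral_id_gaussianReal] at this
  exact this.symm

lemma integral_sq_gaussianReal (m : ℝ) (v : ℝ≥0) :
    ∫ x, x ^ 2 ∂(gaussianReal m v) = v + m ^ 2 := by
  have h1 : Integrable (fun x : ℝ => x) (gaussianReal m v) :=
    (memLp_id_gaussianReal' 1 (by simp)).integrable le_rfl
  have : (fun x : ℝ => x ^ 2) = fun x => (x - m) ^ 2 + (2 * m * x - m ^ 2) := by
    ext x; ring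
  rw [this, integral_add (integrable_sub_sq_gaussianReal m m v)
    (show Integrable (fun x : ℝ => 2 * m * x - m ^ 2) (gaussianReal m v) from
      (h1.const_mul _).sub (integrable_const _)), integral_sub (h1.const_mul _) (integrable_const _),
    integral_const_mul, integral_sub_sq_gaussianReal, integral_id_gaussianReal]
  simp
  ring

lemma integrable_abs_sub_gaussianReal (m a : ℝ) (v : ℝ≥0) :
    Integrable (fun x => |x - a|) (gaussianReal m v) :=
  (((memLp_id_gaussianReal' 1 (by simp)).integrable le_rfl).sub (integrable_const a)).abs

/-- Integrate `|t| ≤ t²/(2√v) + √v/2`. The exact value `√(2v/π)` is not needed: the loss is absorbed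
later by the choice of `2n` for the temperature. -/
lemma integral_abs_sub_gaussianReal_le (m : ℝ) {v : ℝ≥0} (hv : 0 < v) :
    ∫ x, |x - m| ∂(gaussianReal m v) ≤ √v := by
  have hs : 0 < √(v : ℝ) := Real.sqrt_pos.2 (by exact_mod_cast hv)
  have hsq : √(v : ℝ) ^ 2 = v := Real.sq_sqrt v.2
  calc ∫ x, |x - m| ∂(gaussianReal m v)
      ≤ ∫ x, (1 / (2 * √v) * (x - m) ^ 2 + √v / 2) ∂(gaussianReal m v) := by
        refine integral_mono (integrable_abs_sub_gaussianReal m m v)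
          (((integrable_sub_sq_gaussianReal m m v).const_mul _).add (integrable_const _)) fun x => ?_
        have : 1 / (2 * √(v : ℝ)) * (x - m) ^ 2 + √v / 2 - |x - m|
            = (|x - m| - √v) ^ 2 / (2 * √v) := by
          rw [← sq_abs (x - m)]; field_simp; ring
        have h2 : 0 ≤ (|x - m| - √(v : ℝ)) ^ 2 / (2 * √v) := by positivity
        simp only
        linarith
    _ = √v := by
        rw [integral_add ((integrable_sub_sq_gaussianReal m m v).const_mul _) (integrable_const _),
          integral_const_mul, integral_sub_sq_gaussianReal]
        simp only [integral_const, probReal_univ, one_smul]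
        field_simp
        rw [hsq]; ring

/-- The relative entropy between `𝓝(m, v)` and `𝓝(0, w)`. -/
lemma entropyBound_gaussianReal (m : ℝ) {v w : ℝ≥0} (hv : 0 < v) (hw : 0 < w) :
    EntropyBound (gaussianReal m v) (gaussianReal 0 w)
      ((1 / 2) * (Real.log w - Real.log v + (v + m ^ 2) * (1 / (w : ℝ)) - 1)) := by
  rintro h hm ⟨B, hB⟩
  have hv' : (0 : ℝ) < v := by exact_mod_cast hv
  have hw' : (0 : ℝ) < w := by exact_mod_cast hw
  set ρ := gaussianReal m v
  -- `f` is the log-density of `𝓝(m, v)` with respect to `𝓝(0, w)`; its mean under `ρ` is the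
  -- claimed constant.
  let f : ℝ → ℝ := fun x => (1 / 2) * (Real.log w - Real.log v)
    + (1 / (2 * w) * x ^ 2 - 1 / (2 * v) * (x - m) ^ 2)
  have hi2 : Integrable (fun x : ℝ => x ^ 2) ρ := by
    simpa using integrable_sub_sq_gaussianReal m 0 v
  have hi3 := integrable_sub_sq_gaussianReal m m v
  have hfi : Integrable f ρ :=
    (integrable_const _).add ((hi2.const_mul _).sub (hi3.const_mul _))
  have hf : ∫ x, f x ∂ρ =
      (1 / 2) * (Real.log w - Real.log v + (v + m ^ 2) * (1 / (w : ℝ)) - 1) := by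
    simp only [f]
    rw [integral_add (integrable_const _)
        (show Integrable (fun x : ℝ => 1 / (2 * w) * x ^ 2 - 1 / (2 * v) * (x - m) ^ 2) ρ from
          (hi2.const_mul _).sub (hi3.const_mul _)),
      integral_sub (hi2.const_mul _) (hi3.const_mul _), integral_const_mul (1 / (2 * (w : ℝ))),
      integral_const_mul (1 / (2 * (v : ℝ))), integral_sq_gaussianReal,
      integral_sub_sq_gaussianReal]
    simp only [integral_const, probReal_univ, one_smul]
    field_simp
    ring
  have hhi : Integrable h ρ := integrable_of_abs_le hm hB
  have hpdf : ∀ x, gaussianPDFReal m v x * Real.exp (h x - f x)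
      = gaussianPDFReal 0 w x * Real.exp (h x) := by
    intro x
    have e1 : (1 / 2) * (Real.log w - Real.log v) = Real.log (√w) - Real.log (√v) := by
      rw [Real.log_sqrt hw'.le, Real.log_sqrt hv'.le]; ring
    have hsv : 0 < √(v : ℝ) := Real.sqrt_pos.2 hv'
    have hsw : 0 < √(w : ℝ) := Real.sqrt_pos.2 hw'
    have e2 : Real.exp (h x - f x) = Real.exp (h x) * (√v / √w) *
        (Real.exp (-(x ^ 2) / (2 * w)) / Real.exp (-(x - m) ^ 2 / (2 * v))) := by
      simp only [f]
      rw [e1, ← Real.exp_log (div_pos hsv hsw), Real.log_div hsv.ne' hsw.ne', ← Real.exp_add,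
        ← Real.exp_sub, ← Real.exp_add]
      congr 1
      ring
    rw [e2]
    simp only [gaussianPDFReal, sub_zero]
    rw [Real.sqrt_mul (by positivity) (v : ℝ), Real.sqrt_mul (by positivity) (w : ℝ)]
    have := Real.exp_pos (-(x - m) ^ 2 / (2 * v))
    field_simp
  have hexp : ∫ x, Real.exp (h x - f x) ∂ρ = ∫ x, Real.exp (h x) ∂(gaussianReal 0 w) := by
    rw [integral_gaussianReal_eq_integral_smul hv.ne', integral_gaussianReal_eq_integral_smul hw.ne']
    simp_rw [smul_eq_mul, hpdf]
  have hexpi : Integrable (fun x => Real.exp (h x - f x)) ρ := by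
    have h0 : Integrable (fun x => Real.exp (h x)) (gaussianReal 0 w) :=
      integrable_exp_of_abs_le hm hB
    rw [gaussianReal_of_var_ne_zero _ hw.ne', integrable_withDensity_iff_integrable_smul'
      (measurable_gaussianPDF _ _) (ae_of_all _ fun _ => gaussianPDF_lt_top)] at h0
    simp only [ρ]
    rw [gaussianReal_of_var_ne_zero _ hv.ne', integrable_withDensity_iff_integrable_smul'
      (measurable_gaussianPDF _ _) (ae_of_all _ fun _ => gaussianPDF_lt_top)]
    simp only [toReal_gaussianPDF, smul_eq_mul, hpdf] at h0 ⊢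
    exact h0
  -- Jensen's inequality; subtracting the log-density turns the right side into the exponential
  -- moment of `h` under the prior.
  have hj : Real.exp (∫ x, (h x - f x) ∂ρ) ≤ ∫ x, Real.exp (h x - f x) ∂ρ :=
    convexOn_exp.map_integral_le Real.continuous_exp.continuousOn isClosed_univ
      (ae_of_all _ fun _ => Set.mem_univ _) (hhi.sub hfi) hexpi
  rw [hexp, integral_sub hhi hfi, hf] at hj
  have := (Real.le_log_iff_exp_le (integral_exp_pos_of_abs_le hm hB)).2 hj
  linarith

/-! ### The zero-one loss and its exponential moments -/

section Loss

variable {m₁ m₂ : ℕ}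

/-- The zero-one loss. -/
noncomputable def loss (z : Obs m₁ m₂) (M : Matrix (Fin m₁) (Fin m₂) ℝ) : ℝ :=
  Set.indicator {z : Obs m₁ m₂ | (z.2 : ℝ) * M z.1.1 z.1.2 < 0} 1 z

lemma loss_nonneg (z : Obs m₁ m₂) (M : Matrix (Fin m₁) (Fin m₂) ℝ) : 0 ≤ loss z M :=
  Set.indicator_nonneg (fun _ _ => zero_le_one) _

lemma loss_le_one (z : Obs m₁ m₂) (M : Matrix (Fin m₁) (Fin m₂) ℝ) : loss z M ≤ 1 :=
  Set.indicator_le_self' (fun _ _ => zero_le_one) _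

lemma risk_nonneg (P : Measure (Obs m₁ m₂)) (M : Matrix (Fin m₁) (Fin m₂) ℝ) : 0 ≤ risk P M :=
  measureReal_nonneg

lemma risk_le_one (P : Measure (Obs m₁ m₂)) [IsProbabilityMeasure P]
    (M : Matrix (Fin m₁) (Fin m₂) ℝ) : risk P M ≤ 1 := measureReal_le_one

lemma integral_loss (P : Measure (Obs m₁ m₂)) (M : Matrix (Fin m₁) (Fin m₂) ℝ) :
    ∫ z, loss z M ∂P = risk P M :=
  integral_indicator_one (Set.toFinite _).measurableSet

lemma measurable_loss_const {T : Type*} [MeasurableSpace T] (z : Obs m₁ m₂)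
    {M : T → Matrix (Fin m₁) (Fin m₂) ℝ} (hM : ∀ i j, Measurable fun t => M t i j) :
    Measurable fun t => loss z (M t) := by
  have : MeasurableSet {t | (z.2 : ℝ) * M t z.1.1 z.1.2 < 0} :=
    measurableSet_lt ((hM _ _).const_mul _) measurable_const
  exact (measurable_const (a := (1 : ℝ))).indicator this

lemma measurable_loss {T : Type*} [MeasurableSpace T] {M : T → Matrix (Fin m₁) (Fin m₂) ℝ}
    (hM : ∀ i j, Measurable fun t => M t i j) :
    Measurable fun x : Obs m₁ m₂ × T => loss x.1 (M x.2) :=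
  measurable_from_prod_countable_right fun z => measurable_loss_const z hM

lemma measurable_risk {T : Type*} [MeasurableSpace T] (P : Measure (Obs m₁ m₂))
    [IsProbabilityMeasure P] {M : T → Matrix (Fin m₁) (Fin m₂) ℝ}
    (hM : ∀ i j, Measurable fun t => M t i j) : Measurable fun t => risk P (M t) := by
  simp_rw [← integral_loss]
  exact ((measurable_loss hM).stronglyMeasurable.integral_prod_left (μ := P)).measurable

/-- The deviation `n (1 - e⁻¹) R(M) - n r_n(M)`. -/
noncomputable def deviation {n : ℕ} (P : Measure (Obs m₁ m₂)) (S : Fin n → Obs m₁ m₂)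
    (M : Matrix (Fin m₁) (Fin m₂) ℝ) : ℝ :=
  n * (1 - Real.exp (-1)) * risk P M - ∑ l, loss (S l) M

lemma abs_deviation_le {n : ℕ} (P : Measure (Obs m₁ m₂)) [IsProbabilityMeasure P]
    (S : Fin n → Obs m₁ m₂) (M : Matrix (Fin m₁) (Fin m₂) ℝ) : |deviation P S M| ≤ n := by
  have h0 : (0 : ℝ) ≤ n := n.cast_nonneg
  have he : Real.exp (-1) ≤ 1 := Real.exp_le_one_iff.2 (by norm_num)
  have he' := Real.exp_pos (-1)
  have h1 : ∑ l, loss (S l) M ≤ n := by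
    simpa using Finset.sum_le_sum (s := Finset.univ) fun l _ => loss_le_one (S l) M
  have h2 : 0 ≤ ∑ l, loss (S l) M := Finset.sum_nonneg fun l _ => loss_nonneg _ _
  have h3 : 0 ≤ n * (1 - Real.exp (-1)) * risk P M :=
    mul_nonneg (mul_nonneg h0 (by linarith)) (risk_nonneg P M)
  have h4 : n * (1 - Real.exp (-1)) * risk P M ≤ n := by
    have : (1 - Real.exp (-1)) * risk P M ≤ 1 :=
      mul_le_one₀ (by linarith) (risk_nonneg P M) (risk_le_one P M)
    rw [mul_assoc]
    exact mul_le_of_le_one_right h0 this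
  unfold deviation
  rw [abs_le]
  constructor <;> linarith

lemma measurable_deviation {n : ℕ} {Ω T : Type*} [MeasurableSpace Ω] [MeasurableSpace T]
    (P : Measure (Obs m₁ m₂)) [IsProbabilityMeasure P] {Z : Fin n → Ω → Obs m₁ m₂}
    (hZ : ∀ l, Measurable (Z l)) {M : T → Matrix (Fin m₁) (Fin m₂) ℝ}
    (hM : ∀ i j, Measurable fun t => M t i j) :
    Measurable fun x : Ω × T => deviation P (fun l => Z l x.1) (M x.2) := by
  unfold deviation
  refine (((measurable_risk P hM).comp measurable_snd).const_mul _).sub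
    (Finset.measurable_sum _ fun l _ => ?_)
  exact (measurable_loss hM).comp (((hZ l).comp measurable_fst).prodMk measurable_snd)

lemma exp_neg_loss (z : Obs m₁ m₂) (M : Matrix (Fin m₁) (Fin m₂) ℝ) :
    Real.exp (-1 * loss z M) = 1 - (1 - Real.exp (-1)) * loss z M := by
  by_cases h : z ∈ {z : Obs m₁ m₂ | (z.2 : ℝ) * M z.1.1 z.1.2 < 0} <;> simp [loss, h]

variable {n : ℕ} {Ω : Type*} [MeasurableSpace Ω] {μ : Measure Ω}
  {P : Measure (Obs m₁ m₂)} [IsProbabilityMeasure P] {Z : Fin n → Ω → Obs m₁ m₂}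

/-- The moment generating function of the sum factorizes into `(1 - (1 - e⁻¹) R)ⁿ ≤ exp(-n (1 - e⁻¹)
R)`, which the deterministic part of the deviation cancels exactly. -/
lemma integral_exp_deviation_le (hZ : ∀ l, Measurable (Z l)) (hind : iIndepFun Z μ)
    (hlaw : ∀ l, μ.map (Z l) = P) (M : Matrix (Fin m₁) (Fin m₂) ℝ) :
    ∫ ω, Real.exp (deviation P (fun l => Z l ω) M) ∂μ ≤ 1 := by
  have hlm : Measurable fun z : Obs m₁ m₂ => loss z M := measurable_of_countable _
  have hX : iIndepFun (fun l ω => loss (Z l ω) M) μ := hind.comp (fun _ z => loss z M) fun _ => hlm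
  have hmgf := hX.mgf_sum (t := -1) (fun l => hlm.comp (hZ l)) Finset.univ
  have h1 : ∀ l, mgf (fun ω => loss (Z l ω) M) μ (-1) = 1 - (1 - Real.exp (-1)) * risk P M := by
    intro l
    have hli : Integrable (fun z => loss z M) P :=
      integrable_of_abs_le hlm (B := 1) fun z => by
        rw [abs_of_nonneg (loss_nonneg _ _)]; exact loss_le_one _ _
    calc mgf (fun ω => loss (Z l ω) M) μ (-1)
        = ∫ z, Real.exp (-1 * loss z M) ∂P := by
          rw [← hlaw l, integral_map (hZ l).aemeasurable
            (measurable_of_countable _).aestronglyMeasurable]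
          rfl
      _ = _ := by
          simp_rw [exp_neg_loss]
          rw [integral_sub (integrable_const _) (hli.const_mul _), integral_const_mul,
            integral_loss]
          simp
  have h2 : ∀ ω, Real.exp (deviation P (fun l => Z l ω) M) =
      Real.exp (n * (1 - Real.exp (-1)) * risk P M)
        * Real.exp (-1 * (∑ l, fun ω => loss (Z l ω) M) ω) := by
    intro ω
    rw [← Real.exp_add, deviation]
    simp [sub_eq_add_neg]
  simp_rw [h2]
  rw [integral_const_mul]
  change _ * mgf (∑ l, fun ω => loss (Z l ω) M) μ (-1) ≤ 1
  rw [hmgf, Finset.prod_congr rfl fun l _ => h1 l]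
  have he' := Real.exp_pos (-1)
  have h3 : 0 ≤ 1 - (1 - Real.exp (-1)) * risk P M := by
    have : (1 - Real.exp (-1)) * risk P M ≤ 1 :=
      mul_le_one₀ (by linarith) (risk_nonneg P M) (risk_le_one P M)
    linarith
  have h4 : (1 - (1 - Real.exp (-1)) * risk P M) ^ n ≤
      Real.exp (-(n * (1 - Real.exp (-1)) * risk P M)) := by
    calc _ ≤ Real.exp (-((1 - Real.exp (-1)) * risk P M)) ^ n :=
          pow_le_pow_left₀ h3 (Real.one_sub_le_exp_neg _) n
      _ = _ := by rw [← Real.exp_nat_mul]; congr 1; ring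
  simp only [Finset.prod_const, Finset.card_univ, Fintype.card_fin]
  calc _ ≤ Real.exp (n * (1 - Real.exp (-1)) * risk P M)
        * Real.exp (-(n * (1 - Real.exp (-1)) * risk P M)) := by gcongr
    _ = 1 := by rw [← Real.exp_add]; simp

/-- With large probability the exponential moment of the deviation under a fixed prior is bounded. -/
lemma measure_integral_exp_deviation_lt [IsProbabilityMeasure μ] {T : Type*} [MeasurableSpace T]
    (ν : Measure T) [IsProbabilityMeasure ν] (hZ : ∀ l, Measurable (Z l)) (hind : iIndepFun Z μ)
    (hlaw : ∀ l, μ.map (Z l) = P) {M : T → Matrix (Fin m₁) (Fin m₂) ℝ}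
    (hM : ∀ i j, Measurable fun t => M t i j) {ε : ℝ} (hε : 0 < ε) :
    1 - ε ≤ μ.real {ω | ∫ t, Real.exp (deviation P (fun l => Z l ω) (M t)) ∂ν < 1 / ε} := by
  have hm := measurable_deviation P hZ hM
  set f : Ω → ℝ := fun ω => ∫ t, Real.exp (deviation P (fun l => Z l ω) (M t)) ∂ν with hf
  have hinteg : Integrable (Function.uncurry fun ω t =>
      Real.exp (deviation P (fun l => Z l ω) (M t))) (μ.prod ν) :=
    integrable_exp_of_abs_le hm (B := n) fun x => abs_deviation_le _ _ _
  have hfm : Measurable f := (hm.exp.stronglyMeasurable.integral_prod_right (ν := ν)).measurable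
  have hle : ∫ ω, f ω ∂μ ≤ 1 := by
    rw [hf, integral_integral_swap hinteg]
    calc _ ≤ ∫ _, (1 : ℝ) ∂ν :=
          integral_mono hinteg.integral_prod_right (integrable_const _) fun t =>
            integral_exp_deviation_le hZ hind hlaw (M t)
      _ = 1 := by simp
  have hmarkov := mul_meas_ge_le_integral_of_nonneg (μ := μ) (f := f)
    (ae_of_all _ fun ω => integral_nonneg fun t => (Real.exp_pos _).le)
    hinteg.integral_prod_left (1 / ε)
  have hset : {ω | f ω < 1 / ε} = {ω | 1 / ε ≤ f ω}ᶜ := by ext; simp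
  rw [hset, probReal_compl_eq_one_sub (measurableSet_le measurable_const hfm)]
  have : 1 / ε * μ.real {ω | 1 / ε ≤ f ω} ≤ 1 := hmarkov.trans hle
  rw [div_mul_eq_mul_div, one_mul, div_le_one hε] at this
  linarith

end Loss

/-! ### The PAC-Bayesian bound -/

section Variational

variable {m₁ m₂ K : ℕ}

/-- The space of the factors `(L, R)`. -/
abbrev Factors (m₁ m₂ K : ℕ) : Type := (Fin m₁ → Fin K → ℝ) × (Fin m₂ → Fin K → ℝ)

/-- The matrix `L Rᵀ`. -/
noncomputable def prodMatrix (x : Factors m₁ m₂ K) : Matrix (Fin m₁) (Fin m₂) ℝ :=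
  Matrix.of x.1 * (Matrix.of x.2).transpose

lemma prodMatrix_apply (x : Factors m₁ m₂ K) (i : Fin m₁) (j : Fin m₂) :
    prodMatrix x i j = ∑ k, x.1 i k * x.2 j k := by
  simp [prodMatrix, Matrix.mul_apply]

lemma measurable_prodMatrix (i : Fin m₁) (j : Fin m₂) :
    Measurable fun x : Factors m₁ m₂ K => prodMatrix x i j := by
  simp_rw [prodMatrix_apply]
  fun_prop

/-- The law of an array with independent Gaussian entries. -/
noncomputable def gaussianArray {p : ℕ} (a : Fin p → Fin K → ℝ) (v : Fin p → Fin K → ℝ≥0) :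
    Measure (Fin p → Fin K → ℝ) :=
  Measure.pi fun i => Measure.pi fun k => gaussianReal (a i k) (v i k)

instance {p : ℕ} (a : Fin p → Fin K → ℝ) (v : Fin p → Fin K → ℝ≥0) :
    IsProbabilityMeasure (gaussianArray a v) := by
  unfold gaussianArray; infer_instance

lemma measurePreserving_gaussianArray {p : ℕ} (a : Fin p → Fin K → ℝ) (v : Fin p → Fin K → ℝ≥0)
    (i : Fin p) (k : Fin K) :
    MeasurePreserving (fun x : Fin p → Fin K → ℝ => x i k) (gaussianArray a v)
      (gaussianReal (a i k) (v i k)) :=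
  (measurePreserving_eval (fun k => gaussianReal (a i k) (v i k)) k).comp
    (measurePreserving_eval (fun i => Measure.pi fun k => gaussianReal (a i k) (v i k)) i)

/-- The means of `L`. -/
def VarParam.meanL (ρ : VarParam m₁ m₂ K) : Fin m₁ → Fin K → ℝ := ρ.L0

/-- The means of `R`. -/
def VarParam.meanR (ρ : VarParam m₁ m₂ K) : Fin m₂ → Fin K → ℝ := ρ.R0

/-- The law of `(L, R)` with independent Gaussian entries. -/
noncomputable def VarParam.factorMeasure (ρ : VarParam m₁ m₂ K) : Measure (Factors m₁ m₂ K) :=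
  (gaussianArray ρ.meanL ρ.vL).prod (gaussianArray ρ.meanR ρ.vR)

instance (ρ : VarParam m₁ m₂ K) : IsProbabilityMeasure ρ.factorMeasure := by
  unfold VarParam.factorMeasure; infer_instance

instance (ρ : VarParam m₁ m₂ K) (k : Fin K) : IsProbabilityMeasure (ρ.ργ k) := ρ.ργ_prob k

lemma expectedRisk_eq (P : Measure (Obs m₁ m₂)) [IsProbabilityMeasure P] (ρ : VarParam m₁ m₂ K) :
    expectedRisk P ρ = ∫ x, risk P (prodMatrix x) ∂ρ.factorMeasure := by
  have htm : ρ.toMeasure = (gaussianArray ρ.meanL ρ.vL).prod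
      ((gaussianArray ρ.meanR ρ.vR).prod (Measure.pi ρ.ργ)) := rfl
  have hmp : MeasurePreserving (Prod.map id Prod.fst) ((gaussianArray ρ.meanL ρ.vL).prod
      ((gaussianArray ρ.meanR ρ.vR).prod (Measure.pi ρ.ργ))) ρ.factorMeasure :=
    (MeasurePreserving.id (gaussianArray ρ.meanL ρ.vL)).prod
      (measurePreserving_fst (μ := gaussianArray ρ.meanR ρ.vR) (ν := Measure.pi ρ.ργ))
  rw [expectedRisk, htm, ← hmp.map_eq, integral_map hmp.measurable.aemeasurable
    (measurable_risk P measurable_prodMatrix).aestronglyMeasurable]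
  rfl

lemma expectedRisk_le_one (P : Measure (Obs m₁ m₂)) [IsProbabilityMeasure P]
    (ρ : VarParam m₁ m₂ K) : expectedRisk P ρ ≤ 1 := by
  rw [expectedRisk_eq]
  have hm := measurable_risk P (measurable_prodMatrix (m₁ := m₁) (m₂ := m₂) (K := K))
  have := integral_mono (μ := ρ.factorMeasure) (integrable_of_abs_le hm (B := 1) fun x => by
      rw [abs_of_nonneg (risk_nonneg _ _)]; exact risk_le_one _ _)
    (integrable_const (1 : ℝ)) fun x => risk_le_one P (prodMatrix x)
  simpa using this

lemma expectedRisk_nonneg (P : Measure (Obs m₁ m₂)) (ρ : VarParam m₁ m₂ K) :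
    0 ≤ expectedRisk P ρ := integral_nonneg fun _ => risk_nonneg _ _

/-- Rescaling of standard Gaussian factors by the standard deviations `√γ_k`. -/
noncomputable def rescale (γ : Fin K → ℝ) (x : Factors m₁ m₂ K) : Factors m₁ m₂ K :=
  (fun i k => √(γ k) * x.1 i k, fun j k => √(γ k) * x.2 j k)

/-- The law of standard Gaussian factors. -/
noncomputable def stdFactors (m₁ m₂ K : ℕ) : Measure (Factors m₁ m₂ K) :=
  (gaussianArray (fun _ _ => 0) fun _ _ => 1).prod (gaussianArray (fun _ _ => 0) fun _ _ => 1)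

instance : IsProbabilityMeasure (stdFactors m₁ m₂ K) := by
  unfold stdFactors; infer_instance

lemma measurable_rescale :
    Measurable (Function.uncurry (rescale : (Fin K → ℝ) → Factors m₁ m₂ K → Factors m₁ m₂ K)) := by
  unfold rescale Function.uncurry
  fun_prop

/-- Writing the conditional prior of the factors as a push-forward of standard Gaussians, jointly
measurable in `γ`, allows the chain rule to be used without transition kernels. -/
lemma map_gaussianArray {p : ℕ} (γ : Fin K → ℝ) (hγ : ∀ k, 0 ≤ γ k) :
    (gaussianArray (fun (_ : Fin p) (_ : Fin K) => 0) fun _ _ => 1).map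
        (fun x i k => √(γ k) * x i k) =
      gaussianArray (fun _ _ => 0) fun _ k => (γ k).toNNReal := by
  have h1 : (Measure.pi fun _ : Fin K => gaussianReal 0 1).map (fun x k => √(γ k) * x k) =
      Measure.pi fun k => gaussianReal 0 (γ k).toNNReal := by
    rw [Measure.pi_map_pi (fun k => (measurable_const_mul (√(γ k))).aemeasurable)]
    congr 1
    ext1 k
    rw [gaussianReal_map_const_mul]
    congr 1
    · simp
    · ext; simp [Real.sq_sqrt (hγ k), hγ k]
  have hm : Measurable fun (x : Fin K → ℝ) k => √(γ k) * x k :=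
    measurable_pi_lambda _ fun k => (measurable_pi_apply k).const_mul _
  change _ = Measure.pi fun _ : Fin p => Measure.pi fun k => gaussianReal 0 (γ k).toNNReal
  rw [← h1]
  exact Measure.pi_map_pi (f := fun (_ : Fin p) (x : Fin K → ℝ) k => √(γ k) * x k)
    (fun i => hm.aemeasurable)

lemma map_stdFactors (γ : Fin K → ℝ) (hγ : ∀ k, 0 ≤ γ k) :
    (stdFactors m₁ m₂ K).map (rescale γ) =
      (gaussianArray (fun _ _ => 0) fun _ k => (γ k).toNNReal).prod
        (gaussianArray (fun _ _ => 0) fun _ k => (γ k).toNNReal) := by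
  have hm : ∀ p : ℕ, Measurable fun (x : Fin p → Fin K → ℝ) i k => √(γ k) * x i k := fun p => by
    fun_prop
  rw [← map_gaussianArray γ hγ, ← map_gaussianArray γ hγ, Measure.map_prod_map _ _ (hm _) (hm _)]
  rfl

/-- The part of the penalty that is the relative entropy of `ρ` with respect to the hierarchical
prior. -/
noncomputable def entropy (π : Measure ℝ) (ρ : VarParam m₁ m₂ K) : ℝ :=
  (1 / 2) * ∑ k, (∫ g, 1 / g ∂(ρ.ργ k)) *
      (∑ i, ((ρ.vL i k : ℝ) + ρ.L0 i k ^ 2) + ∑ j, ((ρ.vR j k : ℝ) + ρ.R0 j k ^ 2))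
    - (1 / 2) * ∑ k, (∑ i, Real.log (ρ.vL i k) + ∑ j, Real.log (ρ.vR j k))
    + ∑ k, ((InformationTheory.klDiv (ρ.ργ k) π).toReal
        + ((m₁ : ℝ) + m₂) / 2 * ((∫ g, Real.log g ∂(ρ.ργ k)) - 1))

/-- `E[1/γ_k]`, `E[log γ_k]` and `KL(ρ^{γ_k}, π)` are finite. -/
def VarParam.Admissible (π : Measure ℝ) (ρ : VarParam m₁ m₂ K) : Prop :=
  ∀ k, Integrable (fun g : ℝ => 1 / g) (ρ.ργ k) ∧ Integrable Real.log (ρ.ργ k) ∧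
      InformationTheory.klDiv (ρ.ργ k) π ≠ ⊤

/-- The relative entropy of the factors given the variances. -/
noncomputable def condEntropy (ρ : VarParam m₁ m₂ K) (γ : Fin K → ℝ) : ℝ :=
  ∑ k, ((1 / γ k) * ((1 / 2) *
      (∑ i, ((ρ.vL i k : ℝ) + ρ.L0 i k ^ 2) + ∑ j, ((ρ.vR j k : ℝ) + ρ.R0 j k ^ 2)))
    + Real.log (γ k) * (((m₁ : ℝ) + m₂) / 2)
    - ((1 / 2) * (∑ i, Real.log (ρ.vL i k) + ∑ j, Real.log (ρ.vR j k)) + ((m₁ : ℝ) + m₂) / 2))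

lemma entropyBound_gaussianArray {p : ℕ} (a : Fin p → Fin K → ℝ) {v : Fin p → Fin K → ℝ≥0}
    (hv : ∀ i k, 0 < v i k) {w : Fin K → ℝ≥0} (hw : ∀ k, 0 < w k) :
    EntropyBound (gaussianArray a v) (gaussianArray (fun _ _ => 0) fun _ k => w k)
      (∑ i, ∑ k, (1 / 2) * (Real.log (w k) - Real.log (v i k)
        + (v i k + a i k ^ 2) * (1 / (w k : ℝ)) - 1)) :=
  EntropyBound.pi fun i => EntropyBound.pi fun k =>
    entropyBound_gaussianReal (a i k) (hv i k) (hw k)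

lemma entropyBound_factorMeasure (ρ : VarParam m₁ m₂ K) {γ : Fin K → ℝ} (hγ : ∀ k, 0 < γ k) :
    EntropyBound ρ.factorMeasure ((stdFactors m₁ m₂ K).map (rescale γ)) (condEntropy ρ γ) := by
  rw [map_stdFactors γ fun k => (hγ k).le]
  have hw : ∀ k, 0 < (γ k).toNNReal := fun k => Real.toNNReal_pos.2 (hγ k)
  have hb := (entropyBound_gaussianArray ρ.meanL ρ.vL_pos hw).prod
    (entropyBound_gaussianArray ρ.meanR ρ.vR_pos hw)
  suffices he : condEntropy ρ γ = _ by rw [he]; exact hb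
  change _ = ∑ i, ∑ k, (1 / 2) * (Real.log ((γ k).toNNReal : ℝ) - Real.log (ρ.vL i k)
      + (ρ.vL i k + ρ.L0 i k ^ 2) * (1 / ((γ k).toNNReal : ℝ)) - 1)
    + ∑ j, ∑ k, (1 / 2) * (Real.log ((γ k).toNNReal : ℝ) - Real.log (ρ.vR j k)
      + (ρ.vR j k + ρ.R0 j k ^ 2) * (1 / ((γ k).toNNReal : ℝ)) - 1)
  rw [Finset.sum_comm, Finset.sum_comm (s := (Finset.univ : Finset (Fin m₂))),
    ← Finset.sum_add_distrib, condEntropy]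
  refine Finset.sum_congr rfl fun k _ => ?_
  simp only [Real.coe_toNNReal _ (hγ k).le, ← Finset.mul_sum, Finset.sum_add_distrib,
    Finset.sum_sub_distrib, Finset.sum_const, Finset.card_univ, Fintype.card_fin, nsmul_eq_mul,
    ← Finset.sum_mul]
  ring

/-- The conditional Gaussian entropy is affine in `1/γ_k` and `log γ_k`, which is why the penalty
involves the laws of the variances only through these two expectations and the divergence. -/
lemma integral_affine_inv_log {ρ : Fin K → Measure ℝ} [∀ k, IsProbabilityMeasure (ρ k)]
    (hi : ∀ k, Integrable (fun g : ℝ => 1 / g) (ρ k)) (hl : ∀ k, Integrable Real.log (ρ k))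
    (a b c : Fin K → ℝ) :
    Integrable (fun γ : Fin K → ℝ => ∑ k, (1 / γ k * a k + Real.log (γ k) * b k - c k))
        (Measure.pi ρ) ∧
      ∫ γ : Fin K → ℝ, ∑ k, (1 / γ k * a k + Real.log (γ k) * b k - c k) ∂(Measure.pi ρ) =
        ∑ k, ((∫ g, 1 / g ∂(ρ k)) * a k + (∫ g, Real.log g ∂(ρ k)) * b k - c k) := by
  have hi1 : ∀ k, Integrable (fun γ : Fin K → ℝ => 1 / γ k * a k) (Measure.pi ρ) := fun k =>
    (integrable_comp_eval (hi k)).mul_const _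
  have hi2 : ∀ k, Integrable (fun γ : Fin K → ℝ => Real.log (γ k) * b k) (Measure.pi ρ) := fun k =>
    (integrable_comp_eval (hl k)).mul_const _
  have hi3 : ∀ k, Integrable (fun γ : Fin K → ℝ => 1 / γ k * a k + Real.log (γ k) * b k)
    (Measure.pi ρ) := fun k => (hi1 k).add (hi2 k)
  have hi4 : ∀ k, Integrable (fun γ : Fin K → ℝ => 1 / γ k * a k + Real.log (γ k) * b k - c k)
    (Measure.pi ρ) := fun k => (hi3 k).sub (integrable_const _)
  refine ⟨integrable_finsetSum _ fun k _ => hi4 k, ?_⟩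
  rw [integral_finsetSum _ fun k _ => hi4 k]
  refine Finset.sum_congr rfl fun k _ => ?_
  rw [integral_sub (hi3 k) (integrable_const _), integral_add (hi1 k) (hi2 k),
    integral_mul_const, integral_mul_const, integral_comp_eval (hi k).aestronglyMeasurable,
    integral_comp_eval (hl k).aestronglyMeasurable]
  simp

lemma integrable_condEntropy {π : Measure ℝ} {ρ : VarParam m₁ m₂ K} (hρ : ρ.Admissible π) :
    Integrable (condEntropy ρ) (Measure.pi ρ.ργ) :=
  (integral_affine_inv_log (fun k => (hρ k).1) (fun k => (hρ k).2.1) _ _ _).1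

lemma integral_condEntropy {π : Measure ℝ} {ρ : VarParam m₁ m₂ K} (hρ : ρ.Admissible π) :
    ∑ k, (InformationTheory.klDiv (ρ.ργ k) π).toReal + ∫ γ, condEntropy ρ γ ∂(Measure.pi ρ.ργ) =
      entropy π ρ := by
  have h := (integral_affine_inv_log (fun k => (hρ k).1) (fun k => (hρ k).2.1)
    (fun k => (1 / 2) *
      (∑ i, ((ρ.vL i k : ℝ) + ρ.L0 i k ^ 2) + ∑ j, ((ρ.vR j k : ℝ) + ρ.R0 j k ^ 2)))
    (fun _ => ((m₁ : ℝ) + m₂) / 2)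
    (fun k => (1 / 2) * (∑ i, Real.log (ρ.vL i k) + ∑ j, Real.log (ρ.vR j k))
      + ((m₁ : ℝ) + m₂) / 2)).2
  unfold condEntropy entropy
  rw [h, Finset.mul_sum, Finset.mul_sum, ← Finset.sum_sub_distrib, ← Finset.sum_add_distrib,
    ← Finset.sum_add_distrib]
  refine Finset.sum_congr rfl fun k _ => ?_
  ring

/-- The hierarchical prior: the variances and standard Gaussian factors. -/
noncomputable def hierPrior (m₁ m₂ K : ℕ) (π : Measure ℝ) :
    Measure ((Fin K → ℝ) × Factors m₁ m₂ K) :=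
  (Measure.pi fun _ => π).prod (stdFactors m₁ m₂ K)

instance (π : Measure ℝ) [IsProbabilityMeasure π] :
    IsProbabilityMeasure (hierPrior m₁ m₂ K π) := by
  unfold hierPrior; infer_instance

/-- The matrix `L Rᵀ` under the hierarchical prior. -/
noncomputable def priorMatrix (t : (Fin K → ℝ) × Factors m₁ m₂ K) : Matrix (Fin m₁) (Fin m₂) ℝ :=
  prodMatrix (rescale t.1 t.2)

lemma measurable_priorMatrix (i : Fin m₁) (j : Fin m₂) :
    Measurable fun t : (Fin K → ℝ) × Factors m₁ m₂ K => priorMatrix t i j :=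
  (measurable_prodMatrix i j).comp measurable_rescale

/-- Donsker-Varadhan for the whole hierarchical model: the chain rule is applied to a test function
that ignores the variances, which therefore drop out of the left side. -/
lemma integral_le_entropy_add_log {π : Measure ℝ} [IsProbabilityMeasure π] {ρ : VarParam m₁ m₂ K}
    (hρ : ρ.Admissible π) {h : Factors m₁ m₂ K → ℝ} (hm : Measurable h) {B : ℝ}
    (hB : ∀ x, |h x| ≤ B) :
    ∫ x, h x ∂ρ.factorMeasure ≤
      entropy π ρ + Real.log (∫ t, Real.exp (h (rescale t.1 t.2)) ∂(hierPrior m₁ m₂ K π)) := by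
  -- The conditional entropy bound requires nondegenerate Gaussians, hence strictly positive
  -- variances.
  have hpos : ∀ᵐ γ ∂(Measure.pi ρ.ργ), ∀ k, 0 < γ k := by
    refine ae_all_iff.2 fun k => ?_
    have : ∀ᵐ g ∂(ρ.ργ k), 0 < g := by
      rw [ae_iff]; simpa [Set.Iic] using ρ.ργ_pos k
    exact (measurePreserving_eval ρ.ργ k).quasiMeasurePreserving.ae this
  have hb := integral_prod_le_of_entropyBound (h := fun _ x => h x) (π₂ := stdFactors m₁ m₂ K)
    measurable_rescale (EntropyBound.pi fun k => entropyBound_klDiv (hρ k).2.2)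
    (integrable_condEntropy hρ)
    (hpos.mono fun γ hγ => entropyBound_factorMeasure ρ hγ) (hm.comp measurable_snd)
    (fun _ x => hB x)
  rw [integral_condEntropy hρ] at hb
  have hmp : MeasurePreserving Prod.snd ((Measure.pi ρ.ργ).prod ρ.factorMeasure) ρ.factorMeasure :=
    measurePreserving_snd
  rw [← hmp.map_eq, integral_map hmp.measurable.aemeasurable hm.aestronglyMeasurable]
  exact hb

/-! ### The hinge loss under Gaussian factors -/

lemma measurePreserving_entries (ρ : VarParam m₁ m₂ K) (i : Fin m₁) (j : Fin m₂) (k : Fin K) :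
    MeasurePreserving (Prod.map (fun L : Fin m₁ → Fin K → ℝ => L i k)
        (fun R : Fin m₂ → Fin K → ℝ => R j k)) ρ.factorMeasure
      ((gaussianReal (ρ.meanL i k) (ρ.vL i k)).prod (gaussianReal (ρ.meanR j k) (ρ.vR j k))) :=
  (measurePreserving_gaussianArray ρ.meanL ρ.vL i k).prod
    (measurePreserving_gaussianArray ρ.meanR ρ.vR j k)

lemma abs_mul_sub_mul_le (a b a₀ b₀ : ℝ) :
    |a * b - a₀ * b₀| ≤ |a - a₀| * |b - b₀| + |b₀| * |a - a₀| + |a₀| * |b - b₀| := by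
  have : a * b - a₀ * b₀ = (a - a₀) * (b - b₀) + b₀ * (a - a₀) + a₀ * (b - b₀) := by ring
  rw [this, ← abs_mul, ← abs_mul, ← abs_mul]
  exact abs_add_three _ _ _

lemma integrable_abs_mul_sub_mul (a₀ b₀ : ℝ) (v w : ℝ≥0) :
    Integrable (fun x : ℝ × ℝ => |x.1 * x.2 - a₀ * b₀|)
      ((gaussianReal a₀ v).prod (gaussianReal b₀ w)) := by
  have h1 : ∀ m v, Integrable (fun x : ℝ => x) (gaussianReal m v) := fun m v =>
    (memLp_id_gaussianReal' 1 (by simp)).integrable le_rfl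
  exact (((h1 a₀ v).mul_prod (h1 b₀ w)).sub (integrable_const _)).abs

/-- Expand the product around the two means; independence factorizes the cross term. -/
lemma integral_abs_mul_sub_mul_le (a₀ b₀ : ℝ) {v w : ℝ≥0} (hv : 0 < v) (hw : 0 < w) :
    ∫ x : ℝ × ℝ, |x.1 * x.2 - a₀ * b₀| ∂((gaussianReal a₀ v).prod (gaussianReal b₀ w)) ≤
      √v * √w + |b₀| * √v + |a₀| * √w := by
  have iA := integrable_abs_sub_gaussianReal a₀ a₀ v
  have iB := integrable_abs_sub_gaussianReal b₀ b₀ w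
  have bA := integral_abs_sub_gaussianReal_le a₀ hv
  have bB := integral_abs_sub_gaussianReal_le b₀ hw
  have i1 := iA.mul_prod iB
  have i2 := (iA.comp_fst (gaussianReal b₀ w)).const_mul |b₀|
  have i3 := (iB.comp_snd (gaussianReal a₀ v)).const_mul |a₀|
  calc _ ≤ ∫ x : ℝ × ℝ, (|x.1 - a₀| * |x.2 - b₀| + |b₀| * |x.1 - a₀| + |a₀| * |x.2 - b₀|)
          ∂((gaussianReal a₀ v).prod (gaussianReal b₀ w)) :=
        integral_mono (integrable_abs_mul_sub_mul a₀ b₀ v w) ((i1.add i2).add i3) fun x =>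
          abs_mul_sub_mul_le _ _ _ _
    _ = (∫ x, |x - a₀| ∂(gaussianReal a₀ v)) * (∫ x, |x - b₀| ∂(gaussianReal b₀ w))
          + |b₀| * (∫ x, |x - a₀| ∂(gaussianReal a₀ v))
          + |a₀| * (∫ x, |x - b₀| ∂(gaussianReal b₀ w)) := by
        have i12 : Integrable (fun x : ℝ × ℝ => |x.1 - a₀| * |x.2 - b₀| + |b₀| * |x.1 - a₀|)
          ((gaussianReal a₀ v).prod (gaussianReal b₀ w)) := i1.add i2
        rw [integral_add i12 i3, integral_add i1 i2,
          integral_prod_mul (fun x => |x - a₀|) (fun x => |x - b₀|), integral_const_mul,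
          integral_const_mul, integral_fun_fst (fun x => |x - a₀|),
          integral_fun_snd (fun x => |x - b₀|)]
        simp
    _ ≤ _ := by
        have : 0 ≤ ∫ x, |x - b₀| ∂(gaussianReal b₀ w) := integral_nonneg fun _ => abs_nonneg _
        gcongr

/-- If `y a < 0` then `1 ≤ 1 - y a = (1 - y b) + y (b - a)`, and `|y| = 1`. -/
lemma loss_le_hinge (z : Obs m₁ m₂) (M M₀ : Matrix (Fin m₁) (Fin m₂) ℝ) :
    loss z M ≤ max (1 - (z.2 : ℝ) * M₀ z.1.1 z.1.2) 0 + |M z.1.1 z.1.2 - M₀ z.1.1 z.1.2| := by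
  have habs : |(z.2 : ℝ)| = 1 := by
    rcases z.2.2 with h | h
    · rw [h]; simp
    · rw [Set.mem_singleton_iff.1 h]; simp
  set y : ℝ := (z.2 : ℝ)
  set a := M z.1.1 z.1.2
  set b := M₀ z.1.1 z.1.2
  have h2 : y * b - y * a ≤ |a - b| := by
    calc y * b - y * a = y * (b - a) := by ring
      _ ≤ |y * (b - a)| := le_abs_self _
      _ = |a - b| := by rw [abs_mul, habs, one_mul, abs_sub_comm]
  have h3 := le_max_left (1 - y * b) 0
  have h4 := le_max_right (1 - y * b) 0
  by_cases h : y * a < 0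
  · have : loss z M = 1 := by simp [loss, h, y, a]
    linarith
  · have : loss z M = 0 := by simpa [loss, y, a] using h
    rw [this]
    positivity

lemma integral_loss_le (ρ : VarParam m₁ m₂ K) (z : Obs m₁ m₂) :
    ∫ x, loss z (prodMatrix x) ∂ρ.factorMeasure ≤
      max (1 - (z.2 : ℝ) * (ρ.L0 * ρ.R0.transpose) z.1.1 z.1.2) 0 +
        ∑ k, (√(ρ.vL z.1.1 k) * √(ρ.vR z.1.2 k) + |ρ.meanR z.1.2 k| * √(ρ.vL z.1.1 k)
          + |ρ.meanL z.1.1 k| * √(ρ.vR z.1.2 k)) := by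
  have hloss : Measurable fun x : Factors m₁ m₂ K => loss z (prodMatrix x) :=
    measurable_loss_const _ measurable_prodMatrix
  set D : Fin K → ℝ × ℝ → ℝ := fun k x => |x.1 * x.2 - ρ.meanL z.1.1 k * ρ.meanR z.1.2 k| with hD
  have hDi : ∀ k, Integrable (fun x : Factors m₁ m₂ K => D k (x.1 z.1.1 k, x.2 z.1.2 k))
      ρ.factorMeasure := fun k =>
    (measurePreserving_entries ρ z.1.1 z.1.2 k).integrable_comp_of_integrable
      (integrable_abs_mul_sub_mul _ _ _ _)
  calc _ ≤ ∫ x : Factors m₁ m₂ K, (max (1 - (z.2 : ℝ) * (ρ.L0 * ρ.R0.transpose) z.1.1 z.1.2) 0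
        + ∑ k, D k (x.1 z.1.1 k, x.2 z.1.2 k)) ∂ρ.factorMeasure := by
        refine integral_mono (integrable_of_abs_le hloss (B := 1) fun x => by
          rw [abs_of_nonneg (loss_nonneg _ _)]; exact loss_le_one _ _)
          ((integrable_const _).add (integrable_finsetSum _ fun k _ => hDi k)) fun x => ?_
        refine (loss_le_hinge z (prodMatrix x) (ρ.L0 * ρ.R0.transpose)).trans ?_
        gcongr
        rw [prodMatrix_apply, Matrix.mul_apply, ← Finset.sum_sub_distrib]
        exact Finset.abs_sum_le_sum_abs _ _
    _ = max (1 - (z.2 : ℝ) * (ρ.L0 * ρ.R0.transpose) z.1.1 z.1.2) 0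
        + ∑ k, ∫ x : Factors m₁ m₂ K, D k (x.1 z.1.1 k, x.2 z.1.2 k) ∂ρ.factorMeasure := by
        rw [integral_add (integrable_const _) (integrable_finsetSum _ fun k _ => hDi k),
          integral_finsetSum _ fun k _ => hDi k]
        simp
    _ ≤ _ := by
        gcongr with k
        have hmp := measurePreserving_entries ρ z.1.1 z.1.2 k
        have := integral_abs_mul_sub_mul_le (ρ.meanL z.1.1 k) (ρ.meanR z.1.2 k) (ρ.vL_pos z.1.1 k)
          (ρ.vR_pos z.1.2 k)
        rw [← hmp.map_eq, integral_map hmp.measurable.aemeasurable (by fun_prop)] at this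
        exact this

/-- The approximate variational bound controls the expected risk. -/
lemma half_expectedRisk_le {n : ℕ} (hn : 0 < n) {π : Measure ℝ} [IsProbabilityMeasure π]
    (P : Measure (Obs m₁ m₂)) [IsProbabilityMeasure P] (S : Fin n → Obs m₁ m₂) {ε : ℝ}
    (hS : ∫ t, Real.exp (deviation P S (priorMatrix t)) ∂(hierPrior m₁ m₂ K π) < 1 / ε)
    {ρ : VarParam m₁ m₂ K} (hρ : ρ.Admissible π) :
    (n : ℝ) / 2 * expectedRisk P ρ ≤
      2 * n * (hingeRisk S (ρ.L0 * ρ.R0.transpose) + penalty π (2 * n) S ρ)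
        + Real.log (1 / ε) := by
  have hn' : (0 : ℝ) < n := by exact_mod_cast hn
  have hlossm : ∀ l, Measurable fun x : Factors m₁ m₂ K => loss (S l) (prodMatrix x) := fun l =>
    measurable_loss_const _ measurable_prodMatrix
  have hlossi : ∀ l, Integrable (fun x => loss (S l) (prodMatrix x)) ρ.factorMeasure := fun l =>
    integrable_of_abs_le (hlossm l) (B := 1) fun x => by
      rw [abs_of_nonneg (loss_nonneg _ _)]; exact loss_le_one _ _
  have hriskm := measurable_risk P (measurable_prodMatrix (m₁ := m₁) (m₂ := m₂) (K := K))
  have hriski : Integrable (fun x => risk P (prodMatrix x)) ρ.factorMeasure :=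
    integrable_of_abs_le hriskm (B := 1) fun x => by
      rw [abs_of_nonneg (risk_nonneg _ _)]; exact risk_le_one _ _
  have hdm : Measurable fun x : Factors m₁ m₂ K => deviation P S (prodMatrix x) := by
    unfold deviation
    exact (hriskm.const_mul _).sub (Finset.measurable_sum _ fun l _ => hlossm l)
  have hdv := integral_le_entropy_add_log hρ hdm (fun x => abs_deviation_le P S (prodMatrix x))
  have hlog : Real.log (∫ t, Real.exp (deviation P S (priorMatrix t)) ∂(hierPrior m₁ m₂ K π))
      ≤ Real.log (1 / ε) := by
    refine Real.log_le_log ?_ hS.le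
    have hm : Measurable fun t : (Fin K → ℝ) × Factors m₁ m₂ K => deviation P S (priorMatrix t) :=
      hdm.comp measurable_rescale
    exact integral_exp_pos_of_abs_le hm fun t => abs_deviation_le P S _
  have hinteg : ∫ x, deviation P S (prodMatrix x) ∂ρ.factorMeasure =
      n * (1 - Real.exp (-1)) * expectedRisk P ρ
        - ∑ l, ∫ x, loss (S l) (prodMatrix x) ∂ρ.factorMeasure := by
    unfold deviation
    rw [integral_sub (hriski.const_mul _) (integrable_finsetSum _ fun l _ => hlossi l),
      integral_const_mul, integral_finsetSum _ fun l _ => hlossi l, expectedRisk_eq]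
  -- This only uses `e⁻¹ < 1/2`.
  have hhalf : (n : ℝ) / 2 * expectedRisk P ρ ≤ n * (1 - Real.exp (-1)) * expectedRisk P ρ := by
    have := Real.exp_neg_one_lt_half
    refine mul_le_mul_of_nonneg_right ?_ (expectedRisk_nonneg P ρ)
    rw [div_eq_mul_inv]
    exact mul_le_mul_of_nonneg_left (by norm_num at *; linarith) hn'.le
  -- With temperature `2n` the empirical terms of `2n · AVB` carry a factor 2, while the entropy has
  -- factor 1. Since `2 · (2/π) ≥ 1` and `2 √(2/π) ≥ 1`, this factor covers the cruder bound `√v`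
  -- for the mean absolute deviations.
  have hemp : ∑ l, ∫ x, loss (S l) (prodMatrix x) ∂ρ.factorMeasure + entropy π ρ ≤
      2 * n * (hingeRisk S (ρ.L0 * ρ.R0.transpose) + penalty π (2 * n) S ρ) := by
    have hpen : 2 * (n : ℝ) * (hingeRisk S (ρ.L0 * ρ.R0.transpose) + penalty π (2 * n) S ρ) =
        2 * ∑ l, (max (1 - ((S l).2 : ℝ) * (ρ.L0 * ρ.R0.transpose) (S l).1.1 (S l).1.2) 0
          + ∑ k, (√(ρ.vL (S l).1.1 k * (2 / Real.pi)) * √(ρ.vR (S l).1.2 k * (2 / Real.pi))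
            + |ρ.R0 (S l).1.2 k| * √(ρ.vL (S l).1.1 k * (2 / Real.pi))
            + |ρ.L0 (S l).1.1 k| * √(ρ.vR (S l).1.2 k * (2 / Real.pi)))) + entropy π ρ := by
      rw [Finset.sum_add_distrib]
      simp only [hingeRisk, penalty, entropy]
      field_simp
      ring
    rw [hpen, Finset.mul_sum]
    gcongr with l
    refine (integral_loss_le ρ (S l)).trans ?_
    rw [mul_add]
    have hmax := le_max_right (1 - ((S l).2 : ℝ) * (ρ.L0 * ρ.R0.transpose) (S l).1.1 (S l).1.2) 0
    refine add_le_add (by linarith) ?_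
    rw [Finset.mul_sum]
    refine Finset.sum_le_sum fun k _ => ?_
    simp only [Real.sqrt_mul NNReal.zero_le_coe]
    have hpi : (1 : ℝ) / 2 ≤ 2 / Real.pi := by
      rw [div_le_div_iff₀ (by norm_num) Real.pi_pos]; linarith [Real.pi_le_four]
    have hs2 : √(2 / Real.pi) ^ 2 = 2 / Real.pi := Real.sq_sqrt (by positivity)
    have hs : 1 / 2 ≤ √(2 / Real.pi) := Real.le_sqrt_of_sq_le (by norm_num at *; linarith)
    set s := √(2 / Real.pi)
    have a1 : 0 ≤ √(ρ.vL (S l).1.1 k : ℝ) := Real.sqrt_nonneg _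
    have a2 : 0 ≤ √(ρ.vR (S l).1.2 k : ℝ) := Real.sqrt_nonneg _
    set p := √(ρ.vL (S l).1.1 k : ℝ)
    set q := √(ρ.vR (S l).1.2 k : ℝ)
    have e1 : p * q ≤ 2 * s ^ 2 * (p * q) :=
      le_mul_of_one_le_left (by positivity) (by linarith)
    have e2 : |ρ.R0 (S l).1.2 k| * p ≤ 2 * s * (|ρ.R0 (S l).1.2 k| * p) :=
      le_mul_of_one_le_left (by positivity) (by linarith)
    have e3 : |ρ.L0 (S l).1.1 k| * q ≤ 2 * s * (|ρ.L0 (S l).1.1 k| * q) :=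
      le_mul_of_one_le_left (by positivity) (by linarith)
    change p * q + |ρ.R0 (S l).1.2 k| * p + |ρ.L0 (S l).1.1 k| * q ≤ _
    linarith
  have hpm : ∀ t : (Fin K → ℝ) × Factors m₁ m₂ K,
      prodMatrix (rescale t.1 t.2) = priorMatrix t := fun _ => rfl
  simp only [hpm] at hdv
  linarith

end Variational

/-! ### The priors on the variances -/

section Prior

variable {α β : ℝ}

/-- The substitution `x ↦ 1/x` reduces the total mass to the Gamma integral. -/
lemma isProbabilityMeasure_invGammaMeasure (hα : 0 < α) (hβ : 0 < β) :
    IsProbabilityMeasure (invGammaMeasure α β) := by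
  set c := β ^ α / Real.Gamma α with hc
  have hΓ := Real.Gamma_pos_of_pos hα
  have hβα := Real.rpow_pos_of_pos hβ α
  set f : ℝ → ℝ := fun x => c * x ^ (-α - 1) * Real.exp (-β / x) with hf
  have hinteg : ∫ x in Set.Ioi (0 : ℝ), f x = 1 := by
    have h := integral_comp_rpow_Ioi (fun y : ℝ => c * (y ^ (α - 1) * Real.exp (-(β * y))))
      (p := -1) (by norm_num)
    rw [integral_const_mul, Real.integral_rpow_mul_exp_neg_mul_Ioi hα hβ] at h
    have h1 : c * ((1 / β) ^ α * Real.Gamma α) = 1 := by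
      rw [hc, Real.div_rpow zero_le_one hβ.le, Real.one_rpow]
      field_simp
    rw [h1] at h
    rw [← h]
    refine setIntegral_congr_fun measurableSet_Ioi fun x hx => ?_
    have hx : 0 < x := hx
    have e1 : (x ^ (-1 : ℝ)) ^ (α - 1) = x ^ (-(α - 1)) := by
      rw [← Real.rpow_mul hx.le]; congr 1; ring
    have e2 : x ^ (-α - 1) = x ^ ((-1 : ℝ) - 1) * x ^ (-(α - 1)) := by
      rw [← Real.rpow_add hx]; congr 1; ring
    simp only [hf, smul_eq_mul, abs_neg, abs_one, one_mul]
    rw [e1, e2, Real.rpow_neg_one, neg_div, div_eq_mul_inv β x]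
    ring
  -- The Bochner integral of a non-integrable function is 0 by convention, so the value 1 forces
  -- integrability.
  have hfi : IntegrableOn f (Set.Ioi 0) := Integrable.of_integral_ne_zero (by rw [hinteg]; simp)
  constructor
  have hind : (fun x => ENNReal.ofReal (if 0 < x then f x else 0)) =
      (Set.Ioi (0 : ℝ)).indicator fun x => ENNReal.ofReal (f x) := by
    ext x
    by_cases hx : 0 < x <;> simp [hx]
  change (volume.withDensity fun x => ENNReal.ofReal (if 0 < x then f x else 0)) Set.univ = 1
  rw [withDensity_apply _ MeasurableSet.univ, setLIntegral_univ, hind,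
    lintegral_indicator measurableSet_Ioi, ← ofReal_integral_eq_lintegral_ofReal hfi, hinteg]
  · simp
  · refine (ae_restrict_iff' measurableSet_Ioi).2 (ae_of_all _ fun x hx => ?_)
    have hx : 0 < x := hx
    simp only [hf, Pi.zero_apply]
    positivity

lemma isProbabilityMeasure_priorGamma (fam : PriorFamily) (hα : 0 < α) (hβ : 0 < β) :
    IsProbabilityMeasure (priorGamma fam α β) := by
  cases fam
  · exact isProbabilityMeasure_gammaMeasure hα hβ
  · exact isProbabilityMeasure_invGammaMeasure hα hβ

lemma withDensity_Icc_pos {f : ℝ → ℝ≥0∞} (hf : Measurable f) {a b : ℝ} (hab : a < b)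
    (hpos : ∀ x ∈ Set.Icc a b, 0 < f x) : 0 < (volume.withDensity f) (Set.Icc a b) := by
  rw [withDensity_apply _ measurableSet_Icc, setLIntegral_pos_iff hf]
  have : Function.support f ∩ Set.Icc a b = Set.Icc a b :=
    Set.inter_eq_right.2 fun x hx => (hpos x hx).ne'
  rw [this, Real.volume_Icc]
  simpa using hab

lemma priorGamma_Icc_pos (fam : PriorFamily) (hα : 0 < α) (hβ : 0 < β) {a b : ℝ} (ha : 0 < a)
    (hab : a < b) : 0 < priorGamma fam α β (Set.Icc a b) := by
  have hΓ := Real.Gamma_pos_of_pos hα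
  cases fam
  · refine withDensity_Icc_pos (measurable_gammaPDFReal α β).ennreal_ofReal hab fun x hx => ?_
    exact ENNReal.ofReal_pos.2 (gammaPDFReal_pos hα hβ (ha.trans_le hx.1))
  · refine withDensity_Icc_pos ?_ hab fun x hx => ?_
    · refine (Measurable.ite measurableSet_Ioi ?_ measurable_const).ennreal_ofReal
      fun_prop
    · have hx : 0 < x := ha.trans_le hx.1
      rw [if_pos hx]
      refine ENNReal.ofReal_pos.2 ?_
      positivity

/-- A lower bound of the density on the interval times its length. It is polynomial in `a`, which is
what makes variances near 0 affordable under a Gamma prior. -/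
lemma le_gammaMeasure_Icc (hα : 0 < α) (hβ : 0 < β) {a b : ℝ} (ha : 0 < a) (hb : b ≤ 1) :
    β ^ α / Real.Gamma α * Real.exp (-β) * a ^ α * (b - a) ≤
      (gammaMeasure α β).real (Set.Icc a b) := by
  have := isProbabilityMeasure_gammaMeasure hα hβ
  have hΓ := Real.Gamma_pos_of_pos hα
  have hβα := Real.rpow_pos_of_pos hβ α
  set d := β ^ α / Real.Gamma α * Real.exp (-β) * a ^ α
  have hd : 0 ≤ d := by positivity
  rw [measureReal_def, ← ENNReal.ofReal_le_iff_le_toReal (measure_ne_top _ _), gammaMeasure,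
    withDensity_apply _ measurableSet_Icc, ENNReal.ofReal_mul hd, ← Real.volume_Icc,
    ← setLIntegral_const]
  refine setLIntegral_mono' measurableSet_Icc fun x hx => ENNReal.ofReal_le_ofReal ?_
  have hx0 : 0 < x := ha.trans_le hx.1
  have hx1 : x ≤ 1 := hx.2.trans hb
  rw [gammaPDFReal, if_pos hx0.le]
  -- Passing through `x ^ α` handles both signs of `α - 1` at once, as `a ≤ x ≤ 1`.
  have e1 : a ^ α ≤ x ^ (α - 1) :=
    (Real.rpow_le_rpow ha.le hx.1 hα.le).trans
      (Real.rpow_le_rpow_of_exponent_ge hx0 hx1 (by linarith))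
  have e2 : Real.exp (-β) ≤ Real.exp (-(β * x)) :=
    Real.exp_le_exp.2 (by nlinarith)
  calc d = β ^ α / Real.Gamma α * (a ^ α * Real.exp (-β)) := by ring
    _ ≤ β ^ α / Real.Gamma α * (x ^ (α - 1) * Real.exp (-(β * x))) := by gcongr
    _ = _ := by ring

end Prior

/-! ### Conditioned measures -/

/-- The density of the conditioned measure is the constant `1/π(A)` on `A`. -/
lemma klDiv_cond {E : Type*} [MeasurableSpace E] {π : Measure E} [IsProbabilityMeasure π]
    {A : Set E} (hA : MeasurableSet A) (hπ : π A ≠ 0) :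
    InformationTheory.klDiv π[|A] π ≠ ⊤ ∧
      (InformationTheory.klDiv π[|A] π).toReal = -Real.log (π.real A) := by
  have : IsProbabilityMeasure π[|A] := cond_isProbabilityMeasure hπ
  have hac : π[|A] ≪ π := cond_absolutelyContinuous
  have hrn : π[|A].rnDeriv π =ᵐ[π] (π A)⁻¹ • A.indicator 1 := by
    rw [ProbabilityTheory.cond]
    refine (Measure.rnDeriv_smul_left_of_ne_top _ _ (ENNReal.inv_ne_top.2 hπ)).trans ?_
    filter_upwards [Measure.rnDeriv_restrict_self π hA] with x hx
    simp [hx]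
  have hllr : llr π[|A] π =ᵐ[π[|A]] fun _ => -Real.log (π.real A) := by
    filter_upwards [hac.ae_le hrn, ae_cond_mem hA] with x hx hxA
    simp [llr, hx, hxA, measureReal_def]
  have hinteg : Integrable (llr π[|A] π) π[|A] := (integrable_const _).congr hllr.symm
  refine ⟨InformationTheory.klDiv_ne_top hac hinteg, ?_⟩
  rw [InformationTheory.toReal_klDiv_of_measure_eq hac (by simp), integral_congr_ae hllr]
  simp

lemma integral_cond_le {E : Type*} [MeasurableSpace E] {π : Measure E} [IsProbabilityMeasure π]
    {A : Set E} (hA : MeasurableSet A) (hπ : π A ≠ 0) {f : E → ℝ} (hf : Measurable f) {l u : ℝ}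
    (hl : ∀ x ∈ A, l ≤ f x) (hu : ∀ x ∈ A, f x ≤ u) :
    Integrable f π[|A] ∧ ∫ x, f x ∂π[|A] ≤ u := by
  have : IsProbabilityMeasure π[|A] := cond_isProbabilityMeasure hπ
  have hi : Integrable f π[|A] := by
    refine Integrable.of_bound hf.aestronglyMeasurable (max |l| |u|) ?_
    filter_upwards [ae_cond_mem hA] with x hx
    exact abs_le_max_abs_abs (hl x hx) (hu x hx)
  refine ⟨hi, ?_⟩
  have := integral_mono_ae hi (integrable_const u)
    ((ae_cond_mem hA).mono fun x hx => hu x hx)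
  simpa using this

/-! ### Factorizations -/

/-- The columns of `U` form a basis of the column space and the rows of `V` hold the coordinates of
the columns of `M`. In particular `ell` is not an infimum over the empty set. -/
lemma exists_rank_factorization {p q : ℕ} (M : Matrix (Fin p) (Fin q) ℝ) :
    ∃ (U : Matrix (Fin p) (Fin M.rank) ℝ) (V : Matrix (Fin q) (Fin M.rank) ℝ),
      M = U * V.transpose := by
  let W := LinearMap.range M.mulVecLin
  let b : Module.Basis (Fin M.rank) ℝ W := Module.finBasisOfFinrankEq ℝ W rfl
  have hcol : ∀ j, M.col j ∈ W := fun j => ⟨Pi.single j 1, by simp⟩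
  refine ⟨Matrix.of fun i k => (b k : Fin p → ℝ) i,
    Matrix.of fun j k => b.repr ⟨M.col j, hcol j⟩ k, ?_⟩
  ext i j
  have h := congrArg (fun w : W => (w : Fin p → ℝ) i) (b.sum_repr ⟨M.col j, hcol j⟩)
  simp only [Submodule.coe_sum, Submodule.coe_smul, Finset.sum_apply, Pi.smul_apply,
    smul_eq_mul, Matrix.col_apply] at h
  rw [Matrix.mul_apply, ← h]
  simp [mul_comm]

lemma abs_le_maxNorm {p q : ℕ} (A : Matrix (Fin p) (Fin q) ℝ) (i : Fin p) (j : Fin q) :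
    |A i j| ≤ maxNorm A :=
  le_ciSup (f := fun x : Fin p × Fin q => |A x.1 x.2|) (Set.finite_range _).bddAbove (i, j)

lemma maxNorm_nonneg {p q : ℕ} (A : Matrix (Fin p) (Fin q) ℝ) : 0 ≤ maxNorm A :=
  Real.iSup_nonneg fun _ => abs_nonneg _

lemma ell_nonneg {p q : ℕ} (M : Matrix (Fin p) (Fin q) ℝ) : 0 ≤ ell M := by
  refine Real.sInf_nonneg ?_
  rintro t ⟨U, V, -, rfl⟩
  exact (maxNorm_nonneg U).trans (le_max_left _ _)

lemma one_le_rank_mul_ell_sq {p q : ℕ} {M : Matrix (Fin p) (Fin q) ℝ} {i : Fin p} {j : Fin q}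
    (hM : |M i j| = 1) : 1 ≤ M.rank * ell M ^ 2 := by
  have hkey : ∀ t ∈ {t : ℝ | ∃ (U : Matrix (Fin p) (Fin M.rank) ℝ)
      (V : Matrix (Fin q) (Fin M.rank) ℝ), M = U * V.transpose ∧ t = max (maxNorm U) (maxNorm V)},
      0 ≤ t ∧ 1 ≤ M.rank * t ^ 2 := by
    rintro t ⟨U, V, hUV, ht⟩
    have ht0 : 0 ≤ t := by rw [ht]; exact (maxNorm_nonneg U).trans (le_max_left _ _)
    refine ⟨ht0, ?_⟩
    calc (1 : ℝ) = |(U * V.transpose) i j| := by rw [← hUV, hM]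
      _ ≤ ∑ k, |U i k * V j k| := by
        rw [Matrix.mul_apply]; exact Finset.abs_sum_le_sum_abs _ _
      _ ≤ ∑ _k : Fin M.rank, t ^ 2 := by
        refine Finset.sum_le_sum fun k _ => ?_
        rw [abs_mul, sq]
        refine mul_le_mul ?_ ?_ (abs_nonneg _) ht0
        · rw [ht]; exact (abs_le_maxNorm U i k).trans (le_max_left _ _)
        · rw [ht]; exact (abs_le_maxNorm V j k).trans (le_max_right _ _)
      _ = _ := by simp
  obtain ⟨U, V, hUV⟩ := exists_rank_factorization M
  have hr : (0 : ℝ) < M.rank := by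
    have := (hkey _ ⟨U, V, hUV, rfl⟩).2
    by_contra h
    have h0 : (M.rank : ℝ) = 0 := le_antisymm (not_lt.1 h) (Nat.cast_nonneg _)
    rw [h0, zero_mul] at this
    linarith
  -- Taking the root first gives a bound valid for every factorization, which passes to the infimum
  -- without knowing that it is attained.
  have hle : √(1 / M.rank) ≤ ell M := by
    refine le_csInf ⟨_, U, V, hUV, rfl⟩ fun t ht => ?_
    obtain ⟨h0, h1⟩ := hkey t ht
    refine Real.sqrt_le_iff.2 ⟨h0, ?_⟩
    rw [div_le_iff₀ hr]; linarith
  have h2 := pow_le_pow_left₀ (Real.sqrt_nonneg _) hle 2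
  rw [Real.sq_sqrt (by positivity), div_le_iff₀ hr] at h2
  linarith

/-- A factorization with `K` columns whose nonzero columns are the first `rank M` ones and whose
entries are bounded by `2 ℓ(M)`. -/
lemma exists_padded_factorization {p q K : ℕ} {M : Matrix (Fin p) (Fin q) ℝ} (hK : M.rank ≤ K)
    (hell : 0 < ell M) :
    ∃ (U : Matrix (Fin p) (Fin K) ℝ) (V : Matrix (Fin q) (Fin K) ℝ), U * V.transpose = M ∧
      (∀ i k, |U i k| ≤ if (k : ℕ) < M.rank then 2 * ell M else 0) ∧
      (∀ j k, |V j k| ≤ if (k : ℕ) < M.rank then 2 * ell M else 0) := by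
  obtain ⟨U₀, V₀, hUV₀⟩ := exists_rank_factorization M
  -- A factorization attaining the infimum is not needed: since `ell M > 0`, some factorization
  -- stays below `2 * ell M`.
  obtain ⟨t, ⟨U, V, hUV, ht⟩, htlt⟩ := exists_lt_of_csInf_lt (s := {t : ℝ |
      ∃ (U : Matrix (Fin p) (Fin M.rank) ℝ) (V : Matrix (Fin q) (Fin M.rank) ℝ),
        M = U * V.transpose ∧ t = max (maxNorm U) (maxNorm V)})
    ⟨_, U₀, V₀, hUV₀, rfl⟩ (show ell M < 2 * ell M by linarith)
  refine ⟨Matrix.of fun i k => if h : (k : ℕ) < M.rank then U i ⟨k, h⟩ else 0,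
    Matrix.of fun j k => if h : (k : ℕ) < M.rank then V j ⟨k, h⟩ else 0, ?_, ?_, ?_⟩
  · ext i j
    obtain ⟨d, rfl⟩ : ∃ d, K = M.rank + d := ⟨K - M.rank, by omega⟩
    conv_rhs => rw [hUV]
    simp [Matrix.mul_apply, Fin.sum_univ_add]
  · intro i k
    by_cases h : (k : ℕ) < M.rank
    · simp only [Matrix.of_apply, h, dif_pos, if_true]
      refine ((abs_le_maxNorm U i _).trans (le_max_left _ _)).trans (ht ▸ htlt.le)
    · simp [h]
  · intro j k
    by_cases h : (k : ℕ) < M.rank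
    · simp only [Matrix.of_apply, h, dif_pos, if_true]
      refine ((abs_le_maxNorm V j _).trans (le_max_right _ _)).trans (ht ▸ htlt.le)
    · simp [h]

/-! ### Comparison parameters -/

section Comparison

variable {m₁ m₂ K n : ℕ}

/-- The member of the variational class with means `U`, `V`, variances `v k` in the `k`-th columns and
`γ_k` distributed as the prior conditioned on `[a k, b k]`. -/
noncomputable def compParam (π : Measure ℝ) [IsProbabilityMeasure π]
    (U : Matrix (Fin m₁) (Fin K) ℝ) (V : Matrix (Fin m₂) (Fin K) ℝ) (v : Fin K → ℝ≥0)
    (hv : ∀ k, 0 < v k) (a b : Fin K → ℝ) (ha : ∀ k, 0 < a k)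
    (hπ : ∀ k, π (Set.Icc (a k) (b k)) ≠ 0) : VarParam m₁ m₂ K where
  L0 := U
  R0 := V
  vL := fun _ k => v k
  vR := fun _ k => v k
  ργ := fun k => π[|Set.Icc (a k) (b k)]
  vL_pos := fun _ k => hv k
  vR_pos := fun _ k => hv k
  ργ_prob := fun k => cond_isProbabilityMeasure (hπ k)
  ργ_pos := fun k => by
    have h : ∀ᵐ x ∂π[|Set.Icc (a k) (b k)], x ∉ Set.Iic (0 : ℝ) :=
      (ae_cond_mem measurableSet_Icc).mono fun x hx => not_le.2 ((ha k).trans_le hx.1)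
    exact measure_eq_zero_iff_ae_notMem.2 h

/-- A bound for the contribution of a column with entries bounded by `B`, variance `v` and a prior
conditioned on `[a, b]` to `2 n` times the penalty; here `m = m₁ + m₂`. -/
noncomputable def columnCost (π : Measure ℝ) (n : ℕ) (m B v a b : ℝ) : ℝ :=
  2 * n * (v + 2 * B * √v) + m / 2 * ((v + B ^ 2) / a) - m / 2 * Real.log v
    - Real.log (π.real (Set.Icc a b)) + m / 2 * (Real.log b - 1)

variable {π : Measure ℝ}

lemma avb_of_admissible {lam : ℝ} {S : Fin n → Obs m₁ m₂} {ρ : VarParam m₁ m₂ K}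
    (h : ρ.Admissible π) : avb π lam S ρ =
      ((hingeRisk S (ρ.L0 * ρ.R0.transpose) + penalty π lam S ρ : ℝ) : EReal) := if_pos h

lemma avb_of_not_admissible {lam : ℝ} {S : Fin n → Obs m₁ m₂} {ρ : VarParam m₁ m₂ K}
    (h : ¬ ρ.Admissible π) : avb π lam S ρ = ⊤ := if_neg h

variable [IsProbabilityMeasure π] {U : Matrix (Fin m₁) (Fin K) ℝ}
  {V : Matrix (Fin m₂) (Fin K) ℝ} {v : Fin K → ℝ≥0} {hv : ∀ k, 0 < v k} {a b : Fin K → ℝ}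
  {ha : ∀ k, 0 < a k} {hπ : ∀ k, π (Set.Icc (a k) (b k)) ≠ 0}

lemma integral_inv_cond {a b : ℝ} (ha : 0 < a) (hπ : π (Set.Icc a b) ≠ 0) :
    Integrable (fun g : ℝ => 1 / g) π[|Set.Icc a b] ∧ ∫ g, 1 / g ∂π[|Set.Icc a b] ≤ 1 / a :=
  integral_cond_le measurableSet_Icc hπ (by fun_prop) (l := 0)
    (fun _ hx => (one_div_pos.2 (ha.trans_le hx.1)).le) fun _ hx =>
      one_div_le_one_div_of_le ha hx.1

lemma integral_log_cond {a b : ℝ} (ha : 0 < a) (hπ : π (Set.Icc a b) ≠ 0) :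
    Integrable Real.log π[|Set.Icc a b] ∧ ∫ g, Real.log g ∂π[|Set.Icc a b] ≤ Real.log b :=
  integral_cond_le measurableSet_Icc hπ Real.measurable_log (l := Real.log a)
    (fun _ hx => Real.log_le_log ha hx.1) fun _ hx =>
      Real.log_le_log (ha.trans_le hx.1) hx.2

lemma admissible_compParam : (compParam π U V v hv a b ha hπ).Admissible π := fun k =>
  ⟨(integral_inv_cond (ha k) (hπ k)).1, (integral_log_cond (ha k) (hπ k)).1,
    (klDiv_cond measurableSet_Icc (hπ k)).1⟩

/-- Everything decouples over columns after the factors `2/π ≤ 1` are dropped and `E[1/γ] ≤ 1/a`,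
`E[log γ] ≤ log b` are used on the conditioning interval. -/
lemma penalty_compParam_le (hn : 0 < n) (S : Fin n → Obs m₁ m₂) {B : Fin K → ℝ}
    (hU : ∀ i k, |U i k| ≤ B k) (hV : ∀ j k, |V j k| ≤ B k) :
    2 * n * penalty π (2 * n) S (compParam π U V v hv a b ha hπ) ≤
      ∑ k, columnCost π n (m₁ + m₂) (B k) (v k) (a k) (b k) := by
  have hn' : (0 : ℝ) < n := by exact_mod_cast hn
  have hsplit : 2 * n * penalty π (2 * n) S (compParam π U V v hv a b ha hπ) =
      2 * ∑ l, ∑ k, (√(v k * (2 / Real.pi)) * √(v k * (2 / Real.pi))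
        + |V (S l).1.2 k| * √(v k * (2 / Real.pi)) + |U (S l).1.1 k| * √(v k * (2 / Real.pi)))
      + entropy π (compParam π U V v hv a b ha hπ) := by
    simp only [penalty, entropy, compParam]
    field_simp
  have hfirst : ∀ l, ∑ k, (√(v k * (2 / Real.pi)) * √(v k * (2 / Real.pi))
        + |V (S l).1.2 k| * √(v k * (2 / Real.pi)) + |U (S l).1.1 k| * √(v k * (2 / Real.pi)))
      ≤ ∑ k, ((v k : ℝ) + 2 * B k * √(v k)) := by
    intro l
    refine Finset.sum_le_sum fun k _ => ?_
    have hpi : 2 / Real.pi ≤ 1 := (div_le_one Real.pi_pos).2 Real.two_le_pi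
    have hle : (v k : ℝ) * (2 / Real.pi) ≤ v k := mul_le_of_le_one_right (v k).2 hpi
    have hs : √(v k * (2 / Real.pi)) ≤ √(v k : ℝ) := Real.sqrt_le_sqrt hle
    rw [Real.mul_self_sqrt (by positivity)]
    have hB : 0 ≤ B k := (abs_nonneg _).trans (hU (S l).1.1 k)
    have e1 := mul_le_mul (hV (S l).1.2 k) hs (Real.sqrt_nonneg _) hB
    have e2 := mul_le_mul (hU (S l).1.1 k) hs (Real.sqrt_nonneg _) hB
    linarith
  have hsum : 2 * ∑ l, ∑ k, (√(v k * (2 / Real.pi)) * √(v k * (2 / Real.pi))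
        + |V (S l).1.2 k| * √(v k * (2 / Real.pi)) + |U (S l).1.1 k| * √(v k * (2 / Real.pi)))
      ≤ ∑ k, 2 * n * ((v k : ℝ) + 2 * B k * √(v k)) := by
    have := Finset.sum_le_sum (s := Finset.univ) fun l _ => hfirst l
    simp only [Finset.sum_const, Finset.card_univ, Fintype.card_fin, nsmul_eq_mul] at this
    rw [← Finset.mul_sum]
    linarith
  have hent : entropy π (compParam π U V v hv a b ha hπ) ≤
      ∑ k, (((m₁ : ℝ) + m₂) / 2 * ((v k + B k ^ 2) / a k) - ((m₁ : ℝ) + m₂) / 2 * Real.log (v k)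
        - Real.log (π.real (Set.Icc (a k) (b k)))
        + ((m₁ : ℝ) + m₂) / 2 * (Real.log (b k) - 1)) := by
    unfold entropy
    rw [Finset.mul_sum, Finset.mul_sum, ← Finset.sum_sub_distrib, ← Finset.sum_add_distrib]
    refine Finset.sum_le_sum fun k _ => ?_
    simp only [compParam]
    rw [(klDiv_cond measurableSet_Icc (hπ k)).2]
    have hinv := (integral_inv_cond (ha k) (hπ k)).2
    have hlog := (integral_log_cond (ha k) (hπ k)).2
    have hsU : ∑ i, ((v k : ℝ) + U i k ^ 2) ≤ m₁ * (v k + B k ^ 2) := by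
      have := Finset.sum_le_sum (s := Finset.univ) fun i _ =>
        add_le_add (le_refl (v k : ℝ)) (sq_le_sq' (neg_le_of_abs_le (hU i k)) (le_of_abs_le (hU i k)))
      simpa [mul_add] using this
    have hsV : ∑ j, ((v k : ℝ) + V j k ^ 2) ≤ m₂ * (v k + B k ^ 2) := by
      have := Finset.sum_le_sum (s := Finset.univ) fun j _ =>
        add_le_add (le_refl (v k : ℝ)) (sq_le_sq' (neg_le_of_abs_le (hV j k)) (le_of_abs_le (hV j k)))
      simpa [mul_add] using this
    have h1 : (∫ g, 1 / g ∂π[|Set.Icc (a k) (b k)]) *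
        (∑ i, ((v k : ℝ) + U i k ^ 2) + ∑ j, ((v k : ℝ) + V j k ^ 2)) ≤
        1 / a k * (m₁ * (v k + B k ^ 2) + m₂ * (v k + B k ^ 2)) := by
      refine mul_le_mul hinv (add_le_add hsU hsV) ?_ (one_div_pos.2 (ha k)).le
      exact add_nonneg (Finset.sum_nonneg fun i _ => by positivity)
        (Finset.sum_nonneg fun i _ => by positivity)
    have h2 : ((m₁ : ℝ) + m₂) / 2 * ((∫ g, Real.log g ∂π[|Set.Icc (a k) (b k)]) - 1) ≤
        ((m₁ : ℝ) + m₂) / 2 * (Real.log (b k) - 1) := by gcongr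
    simp only [Finset.sum_const, Finset.card_univ, Fintype.card_fin, nsmul_eq_mul]
    have h3 : 1 / a k * (m₁ * (v k + B k ^ 2) + m₂ * (v k + B k ^ 2)) =
        ((m₁ : ℝ) + m₂) * ((v k + B k ^ 2) / a k) := by ring
    rw [h3] at h1
    linarith
  have htot := add_le_add hsum hent
  rw [← Finset.sum_add_distrib] at htot
  rw [hsplit]
  refine htot.trans (le_of_eq (Finset.sum_congr rfl fun k _ => ?_))
  unfold columnCost
  ring

/-- On the good event, the risk of a variational estimator is bounded through any comparison parameter
that represents a matrix with vanishing hinge risk. -/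
lemma expectedRisk_le_of_comparison (hn : 0 < n) (P : Measure (Obs m₁ m₂)) [IsProbabilityMeasure P]
    (S : Fin n → Obs m₁ m₂) {ε : ℝ}
    (hS : ∫ t, Real.exp (deviation P S (priorMatrix t)) ∂(hierPrior m₁ m₂ K π) < 1 / ε)
    {M : Matrix (Fin m₁) (Fin m₂) ℝ} (hM : ∀ l, ((S l).2 : ℝ) * M (S l).1.1 (S l).1.2 = 1)
    {ρ ρ' : VarParam m₁ m₂ K} (hρ : IsVariationalEstimator π (2 * (n : ℝ)) S ρ)
    (hρ' : ρ'.Admissible π) (hprod : ρ'.L0 * ρ'.R0.transpose = M) :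
    (n : ℝ) / 2 * expectedRisk P ρ ≤ 2 * n * penalty π (2 * n) S ρ' + Real.log (1 / ε) := by
  have hle := hρ ρ'
  rw [avb_of_admissible hρ'] at hle
  -- The comparison value is finite, so the minimal value cannot be `⊤`.
  have hadm : ρ.Admissible π := by
    by_contra hcon
    rw [avb_of_not_admissible hcon, top_le_iff] at hle
    exact EReal.coe_ne_top _ hle
  rw [avb_of_admissible hadm, EReal.coe_le_coe_iff] at hle
  have hh : hingeRisk S (ρ'.L0 * ρ'.R0.transpose) = 0 := by
    rw [hprod, hingeRisk]
    simp [hM]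
  rw [hh, zero_add] at hle
  refine (half_expectedRisk_le hn P S hS hadm).trans ?_
  gcongr

end Comparison

/-! ### Costs of the columns -/

lemma half_le_log {x : ℝ} (hx : 2 ≤ x) : 1 / 2 ≤ Real.log x := by
  have := Real.log_two_gt_d9
  have := Real.log_le_log (by norm_num) hx
  linarith

/-- A column with variance `1 / n²` and a prior conditioned on `[1, 2]`. -/
lemma columnCost_signal_le {π : Measure ℝ} [IsProbabilityMeasure π] {n : ℕ} {m B ell : ℝ}
    (hn : 2 ≤ n) (hm : 2 ≤ m) (hB : 0 ≤ B) (hBell : B ≤ 2 * ell) :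
    columnCost π n m B (1 / (n : ℝ) ^ 2) 1 2 ≤
      (7 - Real.log (π.real (Set.Icc 1 2))) * (m * (Real.log n + ell ^ 2)) := by
  have hn' : (2 : ℝ) ≤ n := by exact_mod_cast hn
  have hn0 : (0 : ℝ) < n := by linarith
  have hlog := half_le_log hn'
  have hp : Real.log (π.real (Set.Icc 1 2)) ≤ 0 :=
    Real.log_nonpos measureReal_nonneg measureReal_le_one
  set c := Real.log (π.real (Set.Icc 1 2))
  have hs : √(1 / (n : ℝ) ^ 2) = 1 / n := by
    rw [Real.sqrt_div zero_le_one, Real.sqrt_one, Real.sqrt_sq hn0.le]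
  have hl : Real.log (1 / (n : ℝ) ^ 2) = -(2 * Real.log n) := by
    rw [one_div, Real.log_inv, Real.log_pow]; norm_num
  -- The variance `1/n²` is chosen so that `√v = 1/n` cancels the factor `2n`, while `-(m/2) log v`
  -- grows only to `m log n`.
  have h1 : 2 * (n : ℝ) * (1 / (n : ℝ) ^ 2 + 2 * B * (1 / n)) = 2 / n + 4 * B := by
    field_simp; ring
  have h2 : 2 / (n : ℝ) ≤ 1 := (div_le_one hn0).2 hn'
  have h3 : 1 / (n : ℝ) ^ 2 ≤ 1 / 4 := one_div_le_one_div_of_le (by norm_num) (by nlinarith)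
  have h4 : Real.log 2 - 1 ≤ 0 := by linarith [Real.log_two_lt_d9]
  have hB2 : B ^ 2 ≤ 4 * ell ^ 2 := by nlinarith
  have h5 : 4 * B ≤ 4 + 4 * ell ^ 2 := by nlinarith [sq_nonneg (ell - 1)]
  have h6 : m / 2 * ((1 / (n : ℝ) ^ 2 + B ^ 2) / 1) ≤ m / 2 * (1 / 4 + 4 * ell ^ 2) := by
    rw [div_one]; gcongr
  have h7 : m / 2 * (Real.log 2 - 1) ≤ 0 := mul_nonpos_of_nonneg_of_nonpos (by linarith) h4
  -- From `m ≥ 2` and `log n ≥ 1/2`; this absorbs all additive constants into `m log n`.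
  have hmn : 1 ≤ m * Real.log n := by nlinarith
  have hme : 0 ≤ ell ^ 2 := sq_nonneg _
  have hme2 : 2 * ell ^ 2 ≤ m * ell ^ 2 := by gcongr
  have hmm : m / 8 ≤ m * Real.log n / 4 := by nlinarith
  have hc : -c ≤ -c * (m * (Real.log n + ell ^ 2)) :=
    le_mul_of_one_le_right (by linarith) (by nlinarith)
  unfold columnCost
  rw [hs, hl, h1]
  linarith

/-- A column without signal, with variance `1 / n` and a prior conditioned on `[1/n, 1/n + 1/n²]`. -/
lemma columnCost_noise_le {α β : ℝ} (hα : 0 < α) (hβ : 0 < β) {n : ℕ} {m : ℝ} (hn : 2 ≤ n)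
    (hm : 0 ≤ m) (hmn : m ≤ n) :
    columnCost (gammaMeasure α β) n m 0 (1 / (n : ℝ)) (1 / n) (1 / n + 1 / (n : ℝ) ^ 2) ≤
      (7 + α + 2 * |Real.log (β ^ α / Real.Gamma α * Real.exp (-β))|) * Real.log n := by
  have hn' : (2 : ℝ) ≤ n := by exact_mod_cast hn
  have hn0 : (0 : ℝ) < n := by linarith
  have hlog := half_le_log hn'
  have hΓ := Real.Gamma_pos_of_pos hα
  have hβα := Real.rpow_pos_of_pos hβ α
  set c := β ^ α / Real.Gamma α * Real.exp (-β)
  have hc : 0 < c := by positivity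
  have hb : 1 / (n : ℝ) + 1 / (n : ℝ) ^ 2 ≤ 1 := by
    have h1 : 1 / (n : ℝ) ≤ 1 / 2 := one_div_le_one_div_of_le (by norm_num) hn'
    have h2 : 1 / (n : ℝ) ^ 2 ≤ 1 / 4 := one_div_le_one_div_of_le (by norm_num) (by nlinarith)
    linarith
  have hmass := le_gammaMeasure_Icc hα hβ (one_div_pos.2 hn0) hb
  have hpos : 0 < c * (1 / (n : ℝ)) ^ α * (1 / (n : ℝ) ^ 2) := by positivity
  rw [add_sub_cancel_left] at hmass
  have hlogp := Real.log_le_log hpos hmass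
  have hexp : Real.log (c * (1 / (n : ℝ)) ^ α * (1 / (n : ℝ) ^ 2)) =
      Real.log c - (α + 2) * Real.log n := by
    rw [Real.log_mul (by positivity) (by positivity), Real.log_mul hc.ne' (by positivity),
      Real.log_rpow (by positivity), one_div, one_div, Real.log_inv, Real.log_inv, Real.log_pow]
    push_cast
    ring
  rw [hexp] at hlogp
  have hl1 : Real.log (1 / (n : ℝ)) = -Real.log n := by rw [one_div, Real.log_inv]
  -- Here the terms of order `m` cancel: `-(m/2) log v` against `(m/2) log b`, and `(m/2)(v/a) =
  -- m/2` against `-m/2`. The interval length `1/n²` leaves a remainder `m/(2n) ≤ 1/2`, and the mass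
  -- of the interval costs `(α + 2) log n` up to a constant.
  have hl2 : Real.log (1 / (n : ℝ) + 1 / (n : ℝ) ^ 2) ≤ -Real.log n + 1 / n := by
    have : 1 / (n : ℝ) + 1 / (n : ℝ) ^ 2 = 1 / n * (1 + 1 / n) := by field_simp
    rw [this, Real.log_mul (by positivity) (by positivity), hl1]
    have := Real.log_le_sub_one_of_pos (show (0 : ℝ) < 1 + 1 / n by positivity)
    linarith
  have h3 : m / 2 * (Real.log (1 / (n : ℝ) + 1 / (n : ℝ) ^ 2) - 1) ≤
      m / 2 * (-Real.log n + 1 / n - 1) := by gcongr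
  have h4 : m * (1 / n) ≤ 1 := by rw [mul_one_div]; exact (div_le_one hn0).2 hmn
  have h5 : 2 * (n : ℝ) * (1 / (n : ℝ) + 2 * 0 * √(1 / (n : ℝ))) = 2 := by field_simp; ring
  have h6 : (1 / (n : ℝ) + 0 ^ 2) / (1 / n) = 1 := by field_simp; ring
  have h7 := neg_abs_le (Real.log c)
  have h8 : |Real.log c| ≤ 2 * |Real.log c| * Real.log n := by
    nlinarith [abs_nonneg (Real.log c)]
  unfold columnCost
  rw [h5, h6, hl1]
  linarith

/-! ### Rates -/

section Rate

variable {m₁ m₂ K n : ℕ}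

/-- On the good event, the risk of a variational estimator is bounded by the sum of the costs of the
columns. -/
lemma expectedRisk_le_sum_columnCost {π : Measure ℝ} [IsProbabilityMeasure π] (hn : 0 < n)
    (P : Measure (Obs m₁ m₂)) [IsProbabilityMeasure P] (S : Fin n → Obs m₁ m₂) {ε : ℝ}
    (hS : ∫ t, Real.exp (deviation P S (priorMatrix t)) ∂(hierPrior m₁ m₂ K π) < 1 / ε)
    {M : Matrix (Fin m₁) (Fin m₂) ℝ} (hM : ∀ l, ((S l).2 : ℝ) * M (S l).1.1 (S l).1.2 = 1)
    (hK : M.rank ≤ K) (hell : 0 < ell M) {ρ : VarParam m₁ m₂ K}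
    (hρ : IsVariationalEstimator π (2 * (n : ℝ)) S ρ) {v : Fin K → ℝ} (hv : ∀ k, 0 < v k)
    {a b : Fin K → ℝ} (ha : ∀ k, 0 < a k) (hπ : ∀ k, π (Set.Icc (a k) (b k)) ≠ 0) :
    (n : ℝ) / 2 * expectedRisk P ρ ≤
      ∑ k : Fin K, columnCost π n (m₁ + m₂) (if (k : ℕ) < M.rank then 2 * ell M else 0)
        (v k) (a k) (b k) + Real.log (1 / ε) := by
  obtain ⟨U, V, hUV, hU, hV⟩ := exists_padded_factorization hK hell
  have hv' : ∀ k, 0 < (v k).toNNReal := fun k => Real.toNNReal_pos.2 (hv k)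
  refine (expectedRisk_le_of_comparison hn P S hS hM hρ
    (admissible_compParam (U := U) (V := V) (hv := hv') (ha := ha) (hπ := hπ)) hUV).trans ?_
  have := penalty_compParam_le (hv := hv') (ha := ha) (hπ := hπ) hn S hU hV
  simp only [Real.coe_toNNReal _ (hv _).le] at this
  gcongr

lemma le_rate_of_half_mul_le {n : ℕ} (hn : 0 < n) {E c A g : ℝ} (hc : 0 ≤ c) (hA : 0 ≤ A)
    (hg : 0 ≤ g) (h : (n : ℝ) / 2 * E ≤ c * A + g) : E ≤ 2 * (c + 1) * ((A + g) / n) := by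
  have hn' : (0 : ℝ) < n := by exact_mod_cast hn
  rw [mul_div_assoc', le_div_iff₀ hn']
  nlinarith [mul_nonneg hc hg]

/-- The contribution of a column with signal, relative to `(m₁ + m₂) (log n + ℓ²)`. -/
noncomputable def signalConst (π : Measure ℝ) : ℝ := 7 - Real.log (π.real (Set.Icc 1 2))

/-- The contribution of a column without signal, relative to `log n`. -/
noncomputable def noiseConst (α β : ℝ) : ℝ :=
  7 + α + 2 * |Real.log (β ^ α / Real.Gamma α * Real.exp (-β))|

lemma signalConst_nonneg (π : Measure ℝ) [IsProbabilityMeasure π] : 0 ≤ signalConst π := by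
  have : Real.log (π.real (Set.Icc 1 2)) ≤ 0 :=
    Real.log_nonpos measureReal_nonneg measureReal_le_one
  unfold signalConst
  linarith

lemma noiseConst_nonneg {α : ℝ} (hα : 0 < α) (β : ℝ) : 0 ≤ noiseConst α β := by
  unfold noiseConst
  positivity

/-- All `K` columns, zero or not, are given the signal parameters, which requires of the prior only
that it charges `[1, 2]`. Each column pays the full cost, whence the factor `K`. -/
lemma half_expectedRisk_le_mul_card {π : Measure ℝ} [IsProbabilityMeasure π]
    (hπ : π (Set.Icc 1 2) ≠ 0) (hm : 2 ≤ m₁ + m₂) (hmn : m₁ + m₂ ≤ n)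
    (P : Measure (Obs m₁ m₂)) [IsProbabilityMeasure P] (S : Fin n → Obs m₁ m₂) {ε : ℝ}
    (hS : ∫ t, Real.exp (deviation P S (priorMatrix t)) ∂(hierPrior m₁ m₂ K π) < 1 / ε)
    {M : Matrix (Fin m₁) (Fin m₂) ℝ} (hM : ∀ l, ((S l).2 : ℝ) * M (S l).1.1 (S l).1.2 = 1)
    (hr : 1 ≤ M.rank) (hK : M.rank ≤ K) (hell : 0 < ell M) {ρ : VarParam m₁ m₂ K}
    (hρ : IsVariationalEstimator π (2 * (n : ℝ)) S ρ) :
    (n : ℝ) / 2 * expectedRisk P ρ ≤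
      K * (signalConst π * (M.rank * ((m₁ : ℝ) + m₂) * (Real.log n + ell M ^ 2)))
        + Real.log (1 / ε) := by
  have hn : 2 ≤ n := hm.trans hmn
  have hn0 : (0 : ℝ) < n := by exact_mod_cast (by omega : 0 < n)
  have hm' : (2 : ℝ) ≤ (m₁ : ℝ) + m₂ := by exact_mod_cast hm
  refine (expectedRisk_le_sum_columnCost (by omega) P S hS hM hK hell hρ
    (v := fun _ => 1 / (n : ℝ) ^ 2) (a := fun _ => 1) (b := fun _ => 2) (fun _ => by positivity)
    (fun _ => one_pos) (fun _ => hπ)).trans ?_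
  gcongr
  have hX : 0 ≤ Real.log n + ell M ^ 2 := by
    have := Real.log_natCast_nonneg n
    positivity
  have hcol : ∀ k ∈ (Finset.univ : Finset (Fin K)),
      columnCost π n (m₁ + m₂) (if (k : ℕ) < M.rank then 2 * ell M else 0) (1 / (n : ℝ) ^ 2) 1 2 ≤
        signalConst π * (M.rank * ((m₁ : ℝ) + m₂) * (Real.log n + ell M ^ 2)) := by
    intro k _
    refine (columnCost_signal_le (ell := ell M) hn hm' ?_ ?_).trans ?_
    · split_ifs <;> linarith
    · split_ifs <;> linarith
    · change signalConst π * _ ≤ _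
      refine mul_le_mul_of_nonneg_left ?_ (signalConst_nonneg π)
      rw [mul_assoc]
      exact le_mul_of_one_le_left (by positivity) (by exact_mod_cast hr)
  simpa using Finset.sum_le_sum hcol

/-- Only the first `rank M` columns pay the signal cost; the remaining ones use the cheap noise
parameters. -/
lemma half_expectedRisk_le_gamma {α β : ℝ} (hα : 0 < α) (hβ : 0 < β) (hm : 2 ≤ m₁ + m₂)
    (hmn : m₁ + m₂ ≤ n) (hKm : K ≤ m₁ + m₂)
    (P : Measure (Obs m₁ m₂)) [IsProbabilityMeasure P] (S : Fin n → Obs m₁ m₂) {ε : ℝ}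
    (hS : ∫ t, Real.exp (deviation P S (priorMatrix t))
      ∂(hierPrior m₁ m₂ K (gammaMeasure α β)) < 1 / ε)
    {M : Matrix (Fin m₁) (Fin m₂) ℝ} (hM : ∀ l, ((S l).2 : ℝ) * M (S l).1.1 (S l).1.2 = 1)
    (hr : 1 ≤ M.rank) (hK : M.rank ≤ K) (hell : 0 < ell M) {ρ : VarParam m₁ m₂ K}
    (hρ : IsVariationalEstimator (gammaMeasure α β) (2 * (n : ℝ)) S ρ) :
    (n : ℝ) / 2 * expectedRisk P ρ ≤
      (signalConst (gammaMeasure α β) + noiseConst α β)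
        * (M.rank * ((m₁ : ℝ) + m₂) * (Real.log n + ell M ^ 2)) + Real.log (1 / ε) := by
  have hprob := isProbabilityMeasure_gammaMeasure hα hβ
  have hn : 2 ≤ n := hm.trans hmn
  have hn0 : (0 : ℝ) < n := by exact_mod_cast (by omega : 0 < n)
  have hm' : (2 : ℝ) ≤ (m₁ : ℝ) + m₂ := by exact_mod_cast hm
  have hmn' : (m₁ : ℝ) + m₂ ≤ n := by exact_mod_cast hmn
  have hKm' : (K : ℝ) ≤ (m₁ : ℝ) + m₂ := by exact_mod_cast hKm
  have hr' : (1 : ℝ) ≤ M.rank := by exact_mod_cast hr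
  have hpos : ∀ {a b : ℝ}, 0 < a → a < b → gammaMeasure α β (Set.Icc a b) ≠ 0 := fun ha hab =>
    (priorGamma_Icc_pos PriorFamily.gamma hα hβ ha hab).ne'
  refine (expectedRisk_le_sum_columnCost (by omega) P S hS hM hK hell hρ
    (v := fun k => if (k : ℕ) < M.rank then 1 / (n : ℝ) ^ 2 else 1 / n)
    (a := fun k => if (k : ℕ) < M.rank then 1 else 1 / n)
    (b := fun k => if (k : ℕ) < M.rank then 2 else 1 / n + 1 / (n : ℝ) ^ 2)
    (fun k => by split_ifs <;> positivity) (fun k => by split_ifs <;> positivity)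
    (fun k => ?_)).trans ?_
  · have : 0 < 1 / (n : ℝ) ^ 2 := by positivity
    split_ifs
    · exact hpos one_pos one_lt_two
    · exact hpos (by positivity) (by linarith)
  gcongr
  have hlog := Real.log_natCast_nonneg n
  set X := Real.log n + ell M ^ 2 with hXdef
  have hX : Real.log n ≤ X := by have := sq_nonneg (ell M); linarith
  have hX0 : 0 ≤ X := hlog.trans hX
  have hs := signalConst_nonneg (gammaMeasure α β)
  have ht := noiseConst_nonneg hα β
  set s := signalConst (gammaMeasure α β) with hsdef
  have hcol : ∀ k ∈ (Finset.univ : Finset (Fin K)),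
      columnCost (gammaMeasure α β) n (m₁ + m₂) (if (k : ℕ) < M.rank then 2 * ell M else 0)
        (if (k : ℕ) < M.rank then 1 / (n : ℝ) ^ 2 else 1 / n)
        (if (k : ℕ) < M.rank then 1 else 1 / n)
        (if (k : ℕ) < M.rank then 2 else 1 / n + 1 / (n : ℝ) ^ 2) ≤
      (if (k : ℕ) < M.rank then s * (((m₁ : ℝ) + m₂) * X) else 0) + noiseConst α β * X := by
    intro k _
    by_cases hk : (k : ℕ) < M.rank
    · simp only [hk, if_true]
      have := columnCost_signal_le (π := gammaMeasure α β) (ell := ell M) (B := 2 * ell M) hn hm'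
        (by linarith) le_rfl
      refine this.trans (le_add_of_nonneg_right (by positivity))
    · simp only [hk, if_false, zero_add]
      refine (columnCost_noise_le hα hβ hn (by linarith) hmn').trans ?_
      change noiseConst α β * _ ≤ _
      gcongr
  refine (Finset.sum_le_sum hcol).trans ?_
  rw [Finset.sum_add_distrib, ← Finset.sum_filter, Finset.sum_const, Finset.sum_const,
    Finset.card_univ, Fintype.card_fin, nsmul_eq_mul, nsmul_eq_mul]
  have hcard : ((Finset.univ.filter fun k : Fin K => (k : ℕ) < M.rank).card : ℝ) ≤ M.rank := by
    rw [Fin.card_filter_val_lt]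
    exact_mod_cast min_le_right _ _
  have h1 : ((Finset.univ.filter fun k : Fin K => (k : ℕ) < M.rank).card : ℝ)
      * (s * (((m₁ : ℝ) + m₂) * X)) ≤ M.rank * (s * (((m₁ : ℝ) + m₂) * X)) := by gcongr
  -- The noise columns together cost at most `K` times order `X`; `K ≤ m₁ + m₂` and `rank M ≥ 1` fit
  -- this into the rate.
  have h2 : (K : ℝ) * (noiseConst α β * X) ≤ ((m₁ : ℝ) + m₂) * (noiseConst α β * X) := by gcongr
  have h3 : ((m₁ : ℝ) + m₂) * (noiseConst α β * X) ≤
      M.rank * (((m₁ : ℝ) + m₂) * (noiseConst α β * X)) :=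
    le_mul_of_one_le_left (by positivity) hr'
  linarith

end Rate

end OneBit

theorem corollary3p2 (fam : OneBit.PriorFamily) (α β : ℝ) (hα : 0 < α) (hβ : 0 < β) :
    ∃ C : ℝ, 0 < C ∧
      ∀ (m₁ m₂ K n : ℕ), 0 < n →
      ∀ (P : Measure (OneBit.Obs m₁ m₂)) [IsProbabilityMeasure P]
        (MB : Matrix (Fin m₁) (Fin m₂) ℝ),
      OneBit.IsBayesMatrix P MB → MB.rank ≤ K →
      (∀ᵐ z ∂P, (z.2 : ℝ) = Real.sign (MB z.1.1 z.1.2)) →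
      ∀ {Ω : Type*} [MeasurableSpace Ω] (μ : Measure Ω) [IsProbabilityMeasure μ]
        (Z : Fin n → Ω → OneBit.Obs m₁ m₂),
      (∀ l, Measurable (Z l)) → iIndepFun Z μ → (∀ l, μ.map (Z l) = P) →
      ∀ ε : ℝ, 0 < ε →
        1 - 2 * ε ≤ μ.real {ω | ∀ ρ : OneBit.VarParam m₁ m₂ K,
          OneBit.IsVariationalEstimator (OneBit.priorGamma fam α β) (2 * (n : ℝ))
            (fun l => Z l ω) ρ →
          OneBit.expectedRisk P ρ ≤ C * K * OneBit.rate MB n ε ∧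
          (fam = OneBit.PriorFamily.gamma → K ≤ m₁ + m₂ →
            OneBit.expectedRisk P ρ ≤ C * OneBit.rate MB n ε)} := by
  have hprob := OneBit.isProbabilityMeasure_priorGamma fam hα hβ
  have hs := OneBit.signalConst_nonneg (OneBit.priorGamma fam α β)
  have ht := OneBit.noiseConst_nonneg hα β
  set s := OneBit.signalConst (OneBit.priorGamma fam α β) with hsdef
  set t := OneBit.noiseConst α β with htdef
  -- The factor 2 undoes `n/2`, and the `+ 1` accounts for `log(1/ε)`, whose coefficient is 1. The
  -- same constant serves both claims.
  refine ⟨2 * (s + t + 1), by positivity, ?_⟩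
  intro m₁ m₂ K n hn P _ MB hMB hK hnoise Ω _ μ _ Z hZ hind hlaw ε hε
  -- For `ε ≥ 1/2` the probability bound is vacuous; otherwise `log(1/ε) ≥ 0`.
  rcases le_or_gt (1 / 2) ε with hε2 | hε2
  · exact (by linarith : 1 - 2 * ε ≤ 0).trans measureReal_nonneg
  have hg : 0 ≤ Real.log (1 / ε) := Real.log_nonneg (by rw [le_div_iff₀ hε]; linarith)
  have hentry : ∀ i j, |MB i j| = 1 := fun i j => by
    rcases (hMB i j).1 with h | h <;> simp [h]
  obtain ⟨z₀⟩ : Nonempty (OneBit.Obs m₁ m₂) := nonempty_of_isProbabilityMeasure P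
  have hm : 2 ≤ m₁ + m₂ := by
    have := z₀.1.1.pos
    have := z₀.1.2.pos
    omega
  have hre := OneBit.one_le_rank_mul_ell_sq (hentry z₀.1.1 z₀.1.2)
  have hr : 1 ≤ MB.rank := by
    by_contra hcon
    have h0 : MB.rank = 0 := by omega
    rw [h0] at hre
    norm_num at hre
  have hell : 0 < OneBit.ell MB := by
    refine lt_of_le_of_ne (OneBit.ell_nonneg MB) fun h => ?_
    rw [← h] at hre
    norm_num at hre
  have hn' : (0 : ℝ) < n := by exact_mod_cast hn
  have hK' : (1 : ℝ) ≤ K := by exact_mod_cast hr.trans hK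
  have hlogn := Real.log_natCast_nonneg n
  set A := (MB.rank : ℝ) * ((m₁ : ℝ) + m₂) * (Real.log n + OneBit.ell MB ^ 2) with hA
  have hA0 : 0 ≤ A := by positivity
  have hrate : OneBit.rate MB n ε = (A + Real.log (1 / ε)) / n := rfl
  have hmA : (m₁ : ℝ) + m₂ ≤ A := by
    have h1 : ((m₁ : ℝ) + m₂) * 1 ≤ ((m₁ : ℝ) + m₂) * (MB.rank * OneBit.ell MB ^ 2) := by gcongr
    have h2 : 0 ≤ (MB.rank : ℝ) * ((m₁ : ℝ) + m₂) * Real.log n := by positivity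
    rw [hA, mul_add]
    linarith
  -- For small samples the rate is at least 1 by `hmA`, and a risk never exceeds 1. Otherwise `n ≥
  -- m₁ + m₂ ≥ 2`, as the column costs require.
  rcases lt_or_ge n (m₁ + m₂) with hnm | hmn
  · have hrate1 : 1 ≤ OneBit.rate MB n ε := by
      rw [hrate, le_div_iff₀ hn']
      have : (n : ℝ) ≤ (m₁ : ℝ) + m₂ := by exact_mod_cast hnm.le
      linarith
    have hC1 : 1 ≤ 2 * (s + t + 1) * OneBit.rate MB n ε :=
      one_le_mul_of_one_le_of_one_le (by linarith) hrate1
    have hCK : 1 ≤ 2 * (s + t + 1) * K * OneBit.rate MB n ε :=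
      one_le_mul_of_one_le_of_one_le
        (one_le_mul_of_one_le_of_one_le (by linarith) hK') hrate1
    rw [Set.eq_univ_of_forall (s := {ω | _}) fun ω ρ _ =>
      ⟨(OneBit.expectedRisk_le_one P ρ).trans hCK, fun _ _ =>
        (OneBit.expectedRisk_le_one P ρ).trans hC1⟩, probReal_univ]
    linarith
  have hgood := OneBit.measure_integral_exp_deviation_lt
    (OneBit.hierPrior m₁ m₂ K (OneBit.priorGamma fam α β)) hZ hind hlaw
    OneBit.measurable_priorMatrix hε
  have hnoiseZ : ∀ᵐ ω ∂μ, ∀ l,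
      ((Z l ω).2 : ℝ) * MB (Z l ω).1.1 (Z l ω).1.2 = 1 := by
    refine ae_all_iff.2 fun l => ?_
    have h := hnoise
    rw [← hlaw l] at h
    filter_upwards [ae_of_ae_map (hZ l).aemeasurable h] with ω hω
    rw [hω]
    rcases (hMB (Z l ω).1.1 (Z l ω).1.2).1 with h | h <;> simp [h, Real.sign_of_neg]
  refine (by linarith : 1 - 2 * ε ≤ 1 - ε).trans (hgood.trans ?_)
  -- The target event quantifies over all minimizers and need not be measurable; monotonicity of the
  -- outer measure up to null sets suffices.
  refine ENNReal.toReal_mono (measure_ne_top _ _) (measure_mono_ae ?_)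
  filter_upwards [hnoiseZ] with ω hω hS ρ hρ
  constructor
  · have h := OneBit.half_expectedRisk_le_mul_card
      (OneBit.priorGamma_Icc_pos fam hα hβ one_pos one_lt_two).ne' hm hmn P (fun l => Z l ω) hS hω
      hr hK hell hρ
    -- As `K ≥ 1`, the confidence term may also be multiplied by `K`, so that `K` factors out of the
    -- whole rate.
    have h2 : (n : ℝ) / 2 * OneBit.expectedRisk P ρ ≤ (s + t) * (K * A) + K * Real.log (1 / ε) := by
      have e1 : Real.log (1 / ε) ≤ K * Real.log (1 / ε) := le_mul_of_one_le_left hg hK'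
      have e2 : 0 ≤ t * (K * A) := by positivity
      linarith
    have h3 := OneBit.le_rate_of_half_mul_le hn (add_nonneg hs ht) (by positivity)
      (by positivity) h2
    rw [hrate]
    refine h3.trans (le_of_eq ?_)
    ring
  · rintro rfl hKm
    have h := OneBit.half_expectedRisk_le_gamma hα hβ hm hmn hKm P (fun l => Z l ω) hS hω
      hr hK hell hρ
    rw [hrate]
    exact OneBit.le_rate_of_half_mul_le hn (add_nonneg hs ht) hA0 hg h
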